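/- **Setting.** In round $t=1,2,\dots$ a non-empty subset $\mathcal A_t$ of a finite set of arms is offered; arm $a$ has a feature vector $\mathbf x_{t,a}\in\mathbb R^d$ ($d\ge1$), and the user of the round belongs to one of two groups $S_t\in\{s^+,s^-\}$. Pulling arm $a$ yields the reward $r_{t,a}=\langle\boldsymbol\theta^*,\mathbf x_{t,a}\rangle+\epsilon_{t,a}$. Let $(\mathcal F_t)_{t\ge 0}$ be a filtration such that $\mathcal A_t,\mathbf x_{t,a},S_t$ and the pulled arm $a_t$ are $\mathcal F_{t-1}$-measurable and the observed payoff $r_{t,a_t}$ is $\mathcal F_t$-measurable. Assume for all $t,a$: $\epsilon_{t,a}$ is conditionally $1$-sub-Gaussian given $\mathcal F_{t-1}$, i.e. $\mathbb E[e^{u\epsilon_{t,a}}\mid\mathcal F_{t-1}]\le e^{u^2/2}$ for all $u\in\mathbb R$; $r_{t,a}\in[0,1]$ almost surely; $\|\mathbf x_{t,a}\|_2<L$; and $\|\boldsymbol\theta^*\|_2<M$. **Fair-LinUCB** with parameters $\lambda>0$, $\gamma\ge0$ and $\alpha_t$. Put $A_t=\lambda I_d+\sum_{s<t}\mathbf x_{s,a_s}\mathbf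 x_{s,a_s}^{\mathrm T}$, $\hat{\boldsymbol\theta}_t=A_t^{-1}\sum_{s<t}r_{s,a_s}\mathbf x_{s,a_s}$ and $\|\mathbf x\|_{A}=\sqrt{\mathbf x^{\mathrm T}A\mathbf x}$. Let $\bar r^{s^\pm}$ be the mean payoff of the rounds before $t$ whose user is in group $s^\pm$, and $\bar r_a^{s^\pm}$ the mean over those of these rounds in which $a$ was pulled (an empty mean is $0$), and let $F_a=-\operatorname{sign}(\bar r^{s^+}-\bar r^{s^-})\,(\bar r_a^{s^+}-\bar r_a^{s^-})$. In round $t$ the algorithm pulls an arm $a_t\in\mathcal A_t$ that maximizes, with ties broken arbitrarily, $$p_{t,a}=\hat{\boldsymbol\theta}_t^{\mathrm T}\mathbf x_{t,a}+\alpha_t\|\mathbf x_{t,a}\|_{A_t^{-1}}+\frac{\alpha_t\min_{a'\in\mathcal A_t}\|\mathbf x_{t,a'}\|_{A_t^{-1}}}{2}\,(F_a+1)\,\gamma .$$ For a horizon $T\ge2$ and confidence level $\delta=1/T$, the exploration parameters $\alpha_t$ are $\mathcal F_{t-1}$-measurable and lie, for $1\le t\le T$, between the two confidence radii: $$\sqrt\lambda\,\|\boldsymbol\theta^*\|_2+\sqrt{2\log\frac{|A_t|^{1/2}}{|\lambda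 I_d|^{1/2}\,\delta}}\ \le\ \alpha_t\ \le\ \sqrt\lambda\,M+\sqrt{2\log\tfrac1\delta+d\log\Bigl(1+\tfrac{TL^2}{d\lambda}\Bigr)} .$$ **Corollary.** For all $\lambda>0$, $M$, $\Gamma\ge0$ and $c>1$ there is a constant $C'>0$, depending only on $\lambda,M,\Gamma,c$, such that in the above setting, for all $d\ge1$, $T\ge2$, $L$ with $TL\ge c$ and all $0\le\gamma\le\Gamma$, the following holds. Let $a_t^*\in\mathcal A_t$ be an ($\mathcal F_{t-1}$-measurable) arm maximizing $\langle\boldsymbol\theta^*,\mathbf x_{t,a}\rangle$. Then with probability at least $1-1/T$ $$R_T=\sum_{t=1}^T\bigl(\langle\boldsymbol\theta^*,\mathbf x_{t,a_t^*}\rangle-\langle\boldsymbol\theta^*,\mathbf x_{t,a_t}\rangle\bigr)\ \le\ C'\,d\,\sqrt T\,\log(TL),$$ and the expected regret satisfies the same bound: $$\mathbb E\Bigl[\sum_{t=1}^T r_{t,a_t^*}\Bigr]-\mathbb E\Bigl[\sum_{t=1}^T r_{t,a_t}\Bigr]\ \le\ C'\,d\,\sqrt T\,\log(TL).$$ -/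

import Mathlib

namespace FairLinUCB

open MeasureTheory

noncomputable section

/-- The feature space `ℝ^d` with the Euclidean norm. -/
abbrev Feature (d : ℕ) : Type := EuclideanSpace ℝ (Fin d)

/-- The weighted norm `‖v‖_A = √(vᵀ A v)`. -/
def wnorm {d : ℕ} (A : Matrix (Fin d) (Fin d) ℝ) (v : Feature d) : ℝ :=
  √(v.ofLp ⬝ᵥ A.mulVec v.ofLp)

/-! ### Ridge regression along one run
`X s` is the feature vector of the arm pulled in round `s` and `R s` the payoff observed in it.
Rounds are numbered `0, 1, 2, …`; the statistics used to decide in round `t` are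
built from the rounds `s < t`. -/

/-- `A_t = λ I + ∑_{s<t} x_s x_sᵀ`. -/
def gram {d : ℕ} (lam : ℝ) (X : ℕ → Feature d) (t : ℕ) : Matrix (Fin d) (Fin d) ℝ :=
  lam • (1 : Matrix (Fin d) (Fin d) ℝ)
    + ∑ s ∈ Finset.range t, Matrix.vecMulVec (X s).ofLp (X s).ofLp

/-- `b_t = ∑_{s<t} r_s x_s`. -/
def bvec {d : ℕ} (X : ℕ → Feature d) (R : ℕ → ℝ) (t : ℕ) : Feature d :=
  ∑ s ∈ Finset.range t, R s • X s

/-- The ridge estimator `θ̂_t = A_t⁻¹ b_t`. -/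
def ridge {d : ℕ} (lam : ℝ) (X : ℕ → Feature d) (R : ℕ → ℝ) (t : ℕ) : Feature d :=
  WithLp.toLp 2 ((gram lam X t)⁻¹.mulVec (bvec X R t).ofLp)

/-- The self-normalized confidence radius
`√λ ‖θ‖ + √(2 log(|A_t|^{1/2} |λ I|^{-1/2} δ⁻¹))`. -/
def confRadius {d : ℕ} (lam δ : ℝ) (θ : Feature d) (X : ℕ → Feature d) (t : ℕ) : ℝ :=
  √lam * ‖θ‖ + √(2 * Real.log (√(gram lam X t).det
    * (√(lam • (1 : Matrix (Fin d) (Fin d) ℝ)).det)⁻¹ * δ⁻¹))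

/-- The deterministic confidence radius
`√λ M + √(2 log(1/δ) + d log(1 + T L² / (d λ)))` for the horizon `T`. -/
def horizonRadius (d T : ℕ) (lam δ L M : ℝ) : ℝ :=
  √lam * M + √(2 * Real.log (1 / δ) + d * Real.log (1 + T * L ^ 2 / (d * lam)))

/-! ### The bandit and its assumptions -/

/-- `η` is conditionally 1-sub-Gaussian given the σ-algebra `m`:
`E[exp(sη) | m] ≤ exp(s²/2)` for every real `s`. -/
def CondSubGaussian {Ω : Type*} [MeasurableSpace Ω] (μ : Measure Ω) (m : MeasurableSpace Ω)
    (η : Ω → ℝ) : Prop :=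
  ∀ s : ℝ, Integrable (fun ω => Real.exp (s * η ω)) μ ∧
    μ[fun ω => Real.exp (s * η ω)|m] ≤ᵐ[μ] fun _ => Real.exp (s ^ 2 / 2)

/-- The data of a linear contextual bandit with a binary sensitive attribute. The σ-algebra `F t`
is the information available when the arm of round `t` is chosen. -/
structure Bandit (d : ℕ) (Arm Ω : Type*) [mΩ : MeasurableSpace Ω] where
  F : Filtration ℕ mΩ
  /-- the arms offered in round `t` -/
  avail : ℕ → Ω → Finset Arm
  avail_nonempty : ∀ t ω, (avail t ω).Nonempty
  /-- the contextual feature vector of an arm -/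
  x : ℕ → Arm → Ω → Feature d
  /-- whether the user of round `t` belongs to the privileged group `s⁺` -/
  privileged : ℕ → Ω → Bool
  /-- the reward that an arm yields if it is pulled in round `t` -/
  reward : ℕ → Arm → Ω → ℝ
  /-- the true coefficient vector, shared by all arms -/
  θ : Feature d

namespace Bandit

variable {d : ℕ} {Arm Ω : Type*} [MeasurableSpace Ω]

/-- The expected reward `⟨θ, x_{t,a}⟩`. -/
def mean (B : Bandit d Arm Ω) (t : ℕ) (a : Arm) (ω : Ω) : ℝ := inner ℝ B.θ (B.x t a ω)

/-- The noise, so that `r_{t,a} = ⟨θ, x_{t,a}⟩ + ε_{t,a}`. -/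
def noise (B : Bandit d Arm Ω) (t : ℕ) (a : Arm) (ω : Ω) : ℝ := B.reward t a ω - B.mean t a ω

/-- The assumptions on the environment. Features and rewards of arms not on offer
play no role (they may be taken to be `0`). -/
structure Assumptions (B : Bandit d Arm Ω) (μ : Measure Ω) (L M : ℝ) : Prop where
  avail_predictable : ∀ t a, MeasurableSet[B.F t] {ω | a ∈ B.avail t ω}
  x_predictable : ∀ t a, Measurable[B.F t] (B.x t a)
  privileged_predictable : ∀ t, MeasurableSet[B.F t] {ω | B.privileged t ω = true}
  reward_measurable : ∀ t a, Measurable (B.reward t a)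
  noise_subGaussian : ∀ t a, CondSubGaussian μ (B.F t) (B.noise t a)
  reward_mem : ∀ t a, ∀ᵐ ω ∂μ, B.reward t a ω ∈ Set.Icc (0 : ℝ) 1
  norm_x_lt : ∀ t a ω, ‖B.x t a ω‖ < L
  norm_θ_lt : ‖B.θ‖ < M

/-- An arm selection is predictable if the arm of round `t` is determined by `F t`. -/
def Predictable (B : Bandit d Arm Ω) (arm : ℕ → Ω → Arm) : Prop :=
  ∀ t a, MeasurableSet[B.F t] {ω | arm t ω = a}

/-- `best t` is an arm on offer with the largest expected reward. -/
structure IsBestArm (B : Bandit d Arm Ω) (best : ℕ → Ω → Arm) : Prop where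
  predictable : B.Predictable best
  mem : ∀ t ω, best t ω ∈ B.avail t ω
  le : ∀ t ω, ∀ a ∈ B.avail t ω, B.mean t a ω ≤ B.mean t (best t ω) ω

/-- The features of the arms pulled on the sample path `ω`. -/
def pulledX (B : Bandit d Arm Ω) (arm : ℕ → Ω → Arm) (ω : Ω) (s : ℕ) : Feature d :=
  B.x s (arm s ω) ω

/-- The payoffs observed on the sample path `ω`. -/
def payoff (B : Bandit d Arm Ω) (arm : ℕ → Ω → Arm) (ω : Ω) (s : ℕ) : ℝ :=
  B.reward s (arm s ω) ω

/-- The matrix `A_t` on the sample path `ω`. -/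
def A (B : Bandit d Arm Ω) (lam : ℝ) (arm : ℕ → Ω → Arm) (t : ℕ) (ω : Ω) :
    Matrix (Fin d) (Fin d) ℝ :=
  gram lam (B.pulledX arm ω) t

/-- The confidence width `‖x_{t,a}‖_{A_t⁻¹}`. -/
def width (B : Bandit d Arm Ω) (lam : ℝ) (arm : ℕ → Ω → Arm) (t : ℕ) (a : Arm) (ω : Ω) : ℝ :=
  wnorm (B.A lam arm t ω)⁻¹ (B.x t a ω)

/-- `‖x_{t,a_m}‖_{A_t⁻¹}`, the smallest confidence width among the arms on offer. -/
def minWidth (B : Bandit d Arm Ω) (lam : ℝ) (arm : ℕ → Ω → Arm) (t : ℕ) (ω : Ω) : ℝ :=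
  (B.avail t ω).inf' (B.avail_nonempty t ω) fun a => B.width lam arm t a ω

open Classical in
/-- The mean payoff of the rounds `s < t` that satisfy `P`; it is `0` if there is none. -/
def meanPayoff (B : Bandit d Arm Ω) (arm : ℕ → Ω → Arm) (ω : Ω) (t : ℕ) (P : ℕ → Prop) : ℝ :=
  (∑ s ∈ Finset.range t with P s, B.payoff arm ω s) /
    ((Finset.range t).filter P).card

/-- The mean reward `r̄^s` of the group `s` before round `t` (`g = true` for `s⁺`). -/
def groupMean (B : Bandit d Arm Ω) (arm : ℕ → Ω → Arm) (t : ℕ) (ω : Ω) (g : Bool) : ℝ :=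
  B.meanPayoff arm ω t fun s => B.privileged s ω = g

/-- The mean reward `r̄_a^s` that the arm `a` generated for the group `s` before round `t`. -/
def armGroupMean (B : Bandit d Arm Ω) (arm : ℕ → Ω → Arm) (t : ℕ) (a : Arm) (ω : Ω)
    (g : Bool) : ℝ :=
  B.meanPayoff arm ω t fun s => B.privileged s ω = g ∧ arm s ω = a

/-- The fairness penalty `F_a = -sign(r̄^{s⁺} - r̄^{s⁻}) (r̄_a^{s⁺} - r̄_a^{s⁻})`. -/
def penalty (B : Bandit d Arm Ω) (arm : ℕ → Ω → Arm) (t : ℕ) (a : Arm) (ω : Ω) : ℝ :=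
  -Real.sign (B.groupMean arm t ω true - B.groupMean arm t ω false)
    * (B.armGroupMean arm t a ω true - B.armGroupMean arm t a ω false)

/-- The index `p_{t,a} = θ̂_tᵀ x_{t,a} + α_t ‖x_{t,a}‖_{A_t⁻¹} + 𝓛(γ, F_a)`, where
`𝓛(γ, F) = (α_t ‖x_{t,a_m}‖_{A_t⁻¹} / 2) (F + 1) γ`. -/
def index (B : Bandit d Arm Ω) (lam γ : ℝ) (α : ℕ → Ω → ℝ) (arm : ℕ → Ω → Arm)
    (t : ℕ) (a : Arm) (ω : Ω) : ℝ :=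
  inner ℝ (ridge lam (B.pulledX arm ω) (B.payoff arm ω) t) (B.x t a ω)
    + α t ω * B.width lam arm t a ω
    + α t ω * B.minWidth lam arm t ω / 2 * (B.penalty arm t a ω + 1) * γ

/-- `arm` is a run of Fair-LinUCB: each round it pulls an arm on offer with maximal index (ties are
broken by any predictable rule), and then the payoff of that arm is observed. -/
structure IsFairLinUCB (B : Bandit d Arm Ω) (lam γ : ℝ) (α : ℕ → Ω → ℝ)
    (arm : ℕ → Ω → Arm) : Prop where
  predictable : B.Predictable arm
  payoff_observed : ∀ t, Measurable[B.F (t + 1)] fun ω => B.payoff arm ω t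
  mem : ∀ t ω, arm t ω ∈ B.avail t ω
  index_le : ∀ t ω, ∀ a ∈ B.avail t ω,
    B.index lam γ α arm t a ω ≤ B.index lam γ α arm t (arm t ω) ω

/-- The exploration parameters `α_t` are non-anticipating and, up to the horizon `T`, at least
the self-normalized and at most the deterministic confidence radius at level `δ`. -/
structure IsExploration (B : Bandit d Arm Ω) (T : ℕ) (lam δ L M : ℝ) (arm : ℕ → Ω → Arm)
    (α : ℕ → Ω → ℝ) : Prop where
  predictable : ∀ t, Measurable[B.F t] (α t)
  ge : ∀ t < T, ∀ ω, confRadius lam δ B.θ (B.pulledX arm ω) t ≤ α t ω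
  le : ∀ t < T, ∀ ω, α t ω ≤ horizonRadius d T lam δ L M

/-- The cumulative regret `∑_{t<T} (⟨θ, x_{t,a*}⟩ - ⟨θ, x_{t,a_t}⟩)` on the sample path `ω`. -/
def regret (B : Bandit d Arm Ω) (best arm : ℕ → Ω → Arm) (T : ℕ) (ω : Ω) : ℝ :=
  ∑ t ∈ Finset.range T, (B.mean t (best t ω) ω - B.mean t (arm t ω) ω)

/-- The expected regret `E[∑_{t<T} r_{t,a*}] - E[∑_{t<T} r_{t,a_t}]`. -/
def expectedRegret (B : Bandit d Arm Ω) (μ : Measure Ω) (best arm : ℕ → Ω → Arm) (T : ℕ) : ℝ :=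
  (∫ ω, ∑ t ∈ Finset.range T, B.reward t (best t ω) ω ∂μ)
    - ∫ ω, ∑ t ∈ Finset.range T, B.reward t (arm t ω) ω ∂μ

end Bandit

end

end FairLinUCB

namespace FairLinUCB

open MeasureTheory

/-! ### Rank-one updates of positive definite matrices -/

section LinearAlgebra

/-! Let S_t = ∑_{s<t} ε_s x_s be the accumulated noise of the pulled arms. The ridge error is A_t⁻¹
S_t - λ A_t⁻¹ θ, so the issue is to control S_t in the A_t⁻¹-norm for all t < T at once. The process
W_t = (|λ I| / |A_t|)^{1/2} exp(‖S_t‖²_{A_t⁻¹} / 2) is a non-negative supermartingale with W_0 = 1,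
and Ville's inequality keeps it below T outside an event of probability at most 1/T. The
supermartingale property needs no d-dimensional Gaussian integral: by Sherman–Morrison and the
determinant lemma, W_{t+1} / W_t is a mixture of exp(z ε_t - z²/2) over a one-dimensional Gaussian
in z with predictable mean and variance, and for each fixed z the sub-Gaussian assumption applies
(`lintegral_mul_mixture_step_le`).

On the good event every estimate is within α_t times the width. Payoffs in [0, 1] force |F_a| ≤ 1,
so the fairness terms of two arms differ by at most γ α_t times the smallest width. Optimism then
bounds the loss of a round by (2 + γ) α_t times the width of the pulled arm. As a round loses at
most 1 and α_t ≥ 1, the width may be truncated at 1, so no relation between λ and L is needed.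
Cauchy–Schwarz over the rounds and the elliptical potential lemma sum the truncated widths.

It remains to dominate the logarithms by log(T L) although L may be small (`log_one_add_le`). In
expectation the noise drops out, and the bad event costs at most T · (1/T) = 1. -/

lemma posDef_add_vecMulVec {n : Type*} [Fintype n] {A : Matrix n n ℝ} (hA : A.PosDef)
    (x : n → ℝ) :
    (A + Matrix.vecMulVec x x).PosDef := by
  have := Matrix.posSemidef_vecMulVec_self_star x
  rw [star_trivial] at this
  exact hA.add_posSemidef this

variable {n : Type*} [Fintype n] [DecidableEq n]

lemma dotProduct_inv_mulVec_nonneg {A : Matrix n n ℝ} (hA : A.PosDef) (v : n → ℝ) :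
    0 ≤ v ⬝ᵥ A⁻¹.mulVec v := by
  simpa using hA.inv.posSemidef.dotProduct_mulVec_nonneg v

lemma dotProduct_inv_mulVec_comm {A : Matrix n n ℝ} (hA : A.PosDef) (u v : n → ℝ) :
    u ⬝ᵥ A⁻¹.mulVec v = v ⬝ᵥ A⁻¹.mulVec u := by
  have h : A⁻¹.IsSymm := by simpa using hA.inv.isHermitian
  rw [Matrix.dotProduct_mulVec, ← Matrix.mulVec_transpose, h.eq, dotProduct_comm]

lemma mulVec_inv_mulVec {A : Matrix n n ℝ} (hA : A.PosDef) (v : n → ℝ) :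
    A.mulVec (A⁻¹.mulVec v) = v := by
  rw [Matrix.mulVec_mulVec, Matrix.mul_nonsing_inv _ ((Matrix.isUnit_iff_isUnit_det A).1 hA.isUnit),
    Matrix.one_mulVec]

lemma inv_mulVec_mulVec {A : Matrix n n ℝ} (hA : A.PosDef) (v : n → ℝ) :
    A⁻¹.mulVec (A.mulVec v) = v := by
  rw [Matrix.mulVec_mulVec, Matrix.nonsing_inv_mul _ ((Matrix.isUnit_iff_isUnit_det A).1 hA.isUnit),
    Matrix.one_mulVec]

/-- The Cauchy–Schwarz inequality for the inner product given by `A⁻¹`. -/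
lemma sq_dotProduct_inv_mulVec_le {A : Matrix n n ℝ} (hA : A.PosDef) (u v : n → ℝ) :
    (u ⬝ᵥ A⁻¹.mulVec v) ^ 2 ≤ (u ⬝ᵥ A⁻¹.mulVec u) * (v ⬝ᵥ A⁻¹.mulVec v) := by
  have h : ∀ t : ℝ, 0 ≤ (v ⬝ᵥ A⁻¹.mulVec v) * (t * t) + 2 * (u ⬝ᵥ A⁻¹.mulVec v) * t
      + (u ⬝ᵥ A⁻¹.mulVec u) := by
    intro t
    have := dotProduct_inv_mulVec_nonneg hA (u + t • v)
    simp only [Matrix.mulVec_add, Matrix.mulVec_smul, add_dotProduct, dotProduct_add,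
      smul_dotProduct, dotProduct_smul, smul_eq_mul, dotProduct_inv_mulVec_comm hA v u] at this
    linarith
  have := discrim_le_zero h
  rw [discrim] at this
  nlinarith

/-- The matrix determinant lemma. -/
lemma det_add_vecMulVec {A : Matrix n n ℝ} (hA : A.PosDef) (x : n → ℝ) :
    (A + Matrix.vecMulVec x x).det = A.det * (1 + x ⬝ᵥ A⁻¹.mulVec x) := by
  rw [Matrix.vecMulVec_eq Unit, Matrix.det_add_replicateCol_mul_replicateRow
    ((Matrix.isUnit_iff_isUnit_det A).1 hA.isUnit)]
  congr 1
  simp [Matrix.det_unique, Matrix.mul_apply, dotProduct, Matrix.mulVec, Finset.sum_mul,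
    Finset.mul_sum]
  rw [Finset.sum_comm]
  simp [mul_assoc]

/-- The Sherman–Morrison formula, applied to a vector. -/
lemma inv_add_vecMulVec_mulVec {A : Matrix n n ℝ} (hA : A.PosDef) (x v : n → ℝ) :
    (A + Matrix.vecMulVec x x)⁻¹.mulVec v = A⁻¹.mulVec v
      - ((x ⬝ᵥ A⁻¹.mulVec v) / (1 + x ⬝ᵥ A⁻¹.mulVec x)) • A⁻¹.mulVec x := by
  have hq := dotProduct_inv_mulVec_nonneg hA x
  -- The claimed value is verified by applying the updated matrix to it.
  have key : (A + Matrix.vecMulVec x x).mulVec (A⁻¹.mulVec v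
      - ((x ⬝ᵥ A⁻¹.mulVec v) / (1 + x ⬝ᵥ A⁻¹.mulVec x)) • A⁻¹.mulVec x) = v := by
    simp only [Matrix.add_mulVec, Matrix.mulVec_sub, Matrix.mulVec_smul, mulVec_inv_mulVec hA,
      Matrix.vecMulVec_mulVec]
    ext i
    simp
    field_simp
    ring
  conv_lhs => rw [← key]
  exact inv_mulVec_mulVec (posDef_add_vecMulVec hA x) _

/-- The squared `A⁻¹`-norm after a rank-one update of `A` and a step of the vector. -/
lemma dotProduct_inv_add_vecMulVec_mulVec {A : Matrix n n ℝ} (hA : A.PosDef) (x S : n → ℝ)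
    (η : ℝ) :
    (S + η • x) ⬝ᵥ (A + Matrix.vecMulVec x x)⁻¹.mulVec (S + η • x) =
      S ⬝ᵥ A⁻¹.mulVec S + (2 * η * (x ⬝ᵥ A⁻¹.mulVec S) + η ^ 2 * (x ⬝ᵥ A⁻¹.mulVec x)
        - (x ⬝ᵥ A⁻¹.mulVec S) ^ 2) / (1 + x ⬝ᵥ A⁻¹.mulVec x) := by
  have hq := dotProduct_inv_mulVec_nonneg hA x
  rw [inv_add_vecMulVec_mulVec hA]
  simp only [Matrix.mulVec_add, Matrix.mulVec_smul, add_dotProduct, dotProduct_add, dotProduct_sub,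
    smul_dotProduct, dotProduct_smul, smul_eq_mul, dotProduct_inv_mulVec_comm hA S x]
  field_simp
  ring

/-- The determinant of a positive definite matrix is at most the `n`-th power of the mean of its
diagonal entries. -/
lemma det_le_trace_div_pow [Nonempty n] {A : Matrix n n ℝ} (hA : A.PosDef) :
    A.det ≤ (A.trace / Fintype.card n) ^ Fintype.card n := by
  -- AM–GM for the eigenvalues, whose product is the determinant and whose sum is the trace.
  have h := Real.geom_mean_le_arith_mean Finset.univ (fun _ : n => (1 : ℝ)) hA.isHermitian.eigenvalues
    (fun _ _ => zero_le_one) (by simp [Fintype.card_pos]) (fun i _ => (hA.eigenvalues_pos i).le)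
  have hd := hA.isHermitian.det_eq_prod_eigenvalues
  have ht := hA.isHermitian.trace_eq_sum_eigenvalues
  simp only [RCLike.ofReal_real_eq_id, id] at hd ht
  simp only [Real.rpow_one, one_mul, Finset.sum_const, nsmul_eq_mul, mul_one, Finset.card_univ,
    ← hd, ← ht] at h
  have h0 : (Fintype.card n : ℝ) ≠ 0 := by simp
  calc A.det = (A.det ^ (Fintype.card n : ℝ)⁻¹) ^ Fintype.card n := by
        rw [← Real.rpow_natCast, ← Real.rpow_mul hA.det_pos.le, inv_mul_cancel₀ h0, Real.rpow_one]
    _ ≤ _ := pow_le_pow_left₀ (Real.rpow_nonneg hA.det_pos.le _) h _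

end LinearAlgebra

/-! ### The regularized Gram matrix -/

section Gram

variable {d : ℕ} {lam : ℝ}

lemma gram_zero (X : ℕ → Feature d) : gram lam X 0 = lam • 1 := by simp [gram]

lemma gram_succ (X : ℕ → Feature d) (t : ℕ) :
    gram lam X (t + 1) = gram lam X t + Matrix.vecMulVec (X t).ofLp (X t).ofLp := by
  simp [gram, Finset.sum_range_succ, add_assoc]

lemma gram_posDef (hlam : 0 < lam) (X : ℕ → Feature d) (t : ℕ) : (gram lam X t).PosDef := by
  induction t with
  | zero => rw [gram_zero]; exact Matrix.PosDef.one.smul hlam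
  | succ t ih => rw [gram_succ]; exact posDef_add_vecMulVec ih _

lemma dotProduct_ofLp_self (v : Feature d) : v.ofLp ⬝ᵥ v.ofLp = ‖v‖ ^ 2 := by
  rw [EuclideanSpace.norm_sq_eq]
  simp [dotProduct, sq]

lemma trace_gram (X : ℕ → Feature d) (t : ℕ) :
    (gram lam X t).trace = d * lam + ∑ s ∈ Finset.range t, ‖X s‖ ^ 2 := by
  induction t with
  | zero => simp [gram_zero, mul_comm]
  | succ t ih =>
    rw [gram_succ, Matrix.trace_add, ih, Finset.sum_range_succ, Matrix.trace_vecMulVec,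
      dotProduct_ofLp_self, add_assoc]

lemma log_det_gram_le (hd : 1 ≤ d) (hlam : 0 < lam) {X : ℕ → Feature d} {L : ℝ}
    (hX : ∀ s, ‖X s‖ ≤ L) (t : ℕ) :
    Real.log ((gram lam X t).det / lam ^ d) ≤ d * Real.log (1 + t * L ^ 2 / (d * lam)) := by
  have : Nonempty (Fin d) := ⟨⟨0, hd⟩⟩
  have hd' : (0 : ℝ) < d := by exact_mod_cast hd
  have hpos := (gram_posDef hlam X t).det_pos
  rw [← Real.log_pow]
  refine Real.log_le_log (by positivity) ?_
  rw [div_le_iff₀ (by positivity), ← mul_pow]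
  refine (det_le_trace_div_pow (gram_posDef hlam X t)).trans ?_
  rw [Fintype.card_fin, trace_gram]
  have hs : ∑ s ∈ Finset.range t, ‖X s‖ ^ 2 ≤ t * L ^ 2 := by
    simpa using Finset.sum_le_card_nsmul (Finset.range t) (fun s => ‖X s‖ ^ 2) (L ^ 2)
      fun s _ => pow_le_pow_left₀ (norm_nonneg _) (hX s) 2
  refine pow_le_pow_left₀ (by positivity) ?_ d
  have : (1 + t * L ^ 2 / (d * lam)) * lam = (d * lam + t * L ^ 2) / d := by
    field_simp
  rw [this]
  gcongr

/-- `θᵀ A_t⁻¹ θ ≤ ‖θ‖² / λ`. -/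
lemma dotProduct_gram_inv_mulVec_le (hlam : 0 < lam) (X : ℕ → Feature d) (t : ℕ) (v : Feature d) :
    v.ofLp ⬝ᵥ (gram lam X t)⁻¹.mulVec v.ofLp ≤ ‖v‖ ^ 2 / lam := by
  induction t with
  | zero =>
    have h : (lam • (1 : Matrix (Fin d) (Fin d) ℝ))⁻¹ = lam⁻¹ • 1 := by
      apply Matrix.inv_eq_left_inv
      simp [smul_smul, hlam.ne']
    rw [gram_zero, h, Matrix.smul_mulVec, Matrix.one_mulVec, dotProduct_smul, dotProduct_ofLp_self,
      smul_eq_mul, div_eq_inv_mul]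
  | succ t ih =>
    have hA := gram_posDef hlam X t
    have hq := dotProduct_inv_mulVec_nonneg hA (X t).ofLp
    refine le_trans ?_ ih
    -- With step size `0` the update formula only subtracts a square: a rank-one update of the
    -- matrix cannot increase the inverse form.
    have := dotProduct_inv_add_vecMulVec_mulVec hA (X t).ofLp v.ofLp 0
    simp only [zero_smul, add_zero] at this
    rw [gram_succ, this]
    have h2 : 0 ≤ ((X t).ofLp ⬝ᵥ (gram lam X t)⁻¹.mulVec v.ofLp) ^ 2
      / (1 + (X t).ofLp ⬝ᵥ (gram lam X t)⁻¹.mulVec (X t).ofLp) := by positivity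
    have h3 : (2 * 0 * ((X t).ofLp ⬝ᵥ (gram lam X t)⁻¹.mulVec v.ofLp)
      + 0 ^ 2 * ((X t).ofLp ⬝ᵥ (gram lam X t)⁻¹.mulVec (X t).ofLp)
      - ((X t).ofLp ⬝ᵥ (gram lam X t)⁻¹.mulVec v.ofLp) ^ 2)
      / (1 + (X t).ofLp ⬝ᵥ (gram lam X t)⁻¹.mulVec (X t).ofLp)
      = -(((X t).ofLp ⬝ᵥ (gram lam X t)⁻¹.mulVec v.ofLp) ^ 2
      / (1 + (X t).ofLp ⬝ᵥ (gram lam X t)⁻¹.mulVec (X t).ofLp)) := by ring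
    rw [h3]
    linarith

/-- With m = min(1, q), log(1 + q) ≥ log(1 + m) ≥ m / (1 + m) ≥ m / 2. The truncation is essential,
since the logarithm is sublinear. -/
lemma min_one_le_two_mul_log {q : ℝ} (hq : 0 ≤ q) : min 1 q ≤ 2 * Real.log (1 + q) := by
  have h0 : 0 ≤ min 1 q := le_min zero_le_one hq
  have h1 := Real.one_sub_inv_le_log_of_pos (x := 1 + min 1 q) (by linarith)
  have h2 : Real.log (1 + min 1 q) ≤ Real.log (1 + q) :=
    Real.log_le_log (by linarith) (by linarith [min_le_right 1 q])
  have h3 : min 1 q / 2 ≤ 1 - (1 + min 1 q)⁻¹ := by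
    have : 1 - (1 + min 1 q)⁻¹ = min 1 q / (1 + min 1 q) := by field_simp; ring
    rw [this]
    exact div_le_div_of_nonneg_left h0 (by linarith) (by linarith [min_le_left 1 q])
  linarith

/-- The elliptical potential lemma. -/
lemma sum_min_one_le_log_det (hlam : 0 < lam) (X : ℕ → Feature d) (t : ℕ) :
    ∑ s ∈ Finset.range t, min 1 ((X s).ofLp ⬝ᵥ (gram lam X s)⁻¹.mulVec (X s).ofLp)
      ≤ 2 * Real.log ((gram lam X t).det / lam ^ d) := by
  induction t with
  | zero => simp [gram_zero, hlam.ne']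
  | succ t ih =>
    have hA := gram_posDef hlam X t
    have hq := dotProduct_inv_mulVec_nonneg hA (X t).ofLp
    have hpos := hA.det_pos
    -- The determinant grows by exactly the factor 1 + q, so the sum of the log(1 + q) telescopes.
    rw [Finset.sum_range_succ, gram_succ, det_add_vecMulVec hA, mul_div_right_comm,
      Real.log_mul (by positivity) (by positivity)]
    linarith [min_one_le_two_mul_log hq]

end Gram

/-! ### Sub-Gaussian noise -/

section SubGaussian

open ProbabilityTheory
open scoped ENNReal NNReal

variable {Ω : Type*} {m mΩ : MeasurableSpace Ω} {μ : Measure Ω}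

lemma CondSubGaussian.setIntegral_exp_le [IsProbabilityMeasure μ]
    (hm : m ≤ mΩ) {η : Ω → ℝ} (hη : CondSubGaussian μ m η) (z : ℝ) {B : Set Ω}
    (hB : MeasurableSet[m] B) :
    ∫ ω in B, Real.exp (z * η ω) ∂μ ≤ Real.exp (z ^ 2 / 2) * μ.real B := by
  obtain ⟨hint, hle⟩ := hη z
  rw [← setIntegral_condExp hm hint hB]
  refine (setIntegral_mono_ae integrable_condExp.integrableOn
    (integrable_const (Real.exp (z ^ 2 / 2))).integrableOn hle).trans_eq ?_
  rw [setIntegral_const, smul_eq_mul, mul_comm]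

lemma CondSubGaussian.setLIntegral_exp_le [IsProbabilityMeasure μ]
    (hm : m ≤ mΩ) {η : Ω → ℝ} (hη : CondSubGaussian μ m η) (z : ℝ) {B : Set Ω}
    (hB : MeasurableSet[m] B) :
    ∫⁻ ω in B, ENNReal.ofReal (Real.exp (z * η ω)) ∂μ
      ≤ ENNReal.ofReal (Real.exp (z ^ 2 / 2)) * μ B := by
  rw [← ofReal_integral_eq_lintegral_ofReal (hη z).1.integrableOn
    (Filter.Eventually.of_forall fun _ => (Real.exp_pos _).le)]
  refine (ENNReal.ofReal_le_ofReal (hη.setIntegral_exp_le hm z hB)).trans_eq ?_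
  rw [ENNReal.ofReal_mul (Real.exp_pos _).le, ofReal_measureReal]

/-- Conditionally sub-Gaussian noise is conditionally centred. -/
lemma CondSubGaussian.setIntegral_eq_zero [IsProbabilityMeasure μ] (hm : m ≤ mΩ) {η : Ω → ℝ}
    (hη : CondSubGaussian μ m η) (hint : Integrable η μ) {B : Set Ω} (hB : MeasurableSet[m] B) :
    ∫ ω in B, η ω ∂μ = 0 := by
  -- Integrating 1 + zη ≤ exp(zη) over `B` bounds z∫η by (exp(z²/2) - 1) μ(B), which is of second
  -- order in z. Small z of either sign then force the integral to vanish.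
  have key : ∀ z : ℝ, |z| ≤ 1 → z * ∫ ω in B, η ω ∂μ ≤ z ^ 2 := by
    intro z hz
    have h1 : ∫ ω in B, (z * η ω + 1) ∂μ ≤ ∫ ω in B, Real.exp (z * η ω) ∂μ :=
      setIntegral_mono ((hint.const_mul z).add (integrable_const 1)).integrableOn
        (hη z).1.integrableOn fun ω => Real.add_one_le_exp _
    rw [integral_add (hint.const_mul z).integrableOn (integrable_const 1), integral_const_mul] at h1
    simp only [integral_const, smul_eq_mul, mul_one, measureReal_restrict_apply_univ] at h1
    have h2 := hη.setIntegral_exp_le hm z hB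
    have hz2 : z ^ 2 ≤ 1 := by rw [← sq_abs]; exact pow_le_one₀ (abs_nonneg z) hz
    have h3 : Real.exp (z ^ 2 / 2) - 1 ≤ z ^ 2 := by
      have h := Real.abs_exp_sub_one_le (x := z ^ 2 / 2)
        (by rw [abs_of_nonneg (by positivity)]; linarith)
      rw [abs_of_nonneg (a := z ^ 2 / 2) (by positivity)] at h
      linarith [le_abs_self (Real.exp (z ^ 2 / 2) - 1)]
    have h4 : μ.real B ≤ 1 := measureReal_le_one
    have h5 : 0 ≤ μ.real B := measureReal_nonneg
    nlinarith [sq_nonneg z]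
  set a := ∫ ω in B, η ω ∂μ
  by_contra ha
  rcases lt_or_gt_of_ne ha with h | h
  -- For |z| = min(1, |a|/2) with the sign of a, `key` would give |a| ≤ |z| ≤ |a|/2.
  · have hz : 0 < min 1 (-a / 2) := lt_min one_pos (by linarith)
    have := key (-min 1 (-a / 2)) (by rw [abs_neg, abs_of_pos hz]; exact min_le_left _ _)
    nlinarith [min_le_right 1 (-a / 2)]
  · have hz : 0 < min 1 (a / 2) := lt_min one_pos (by linarith)
    have := key (min 1 (a / 2)) (by rw [abs_of_pos hz]; exact min_le_left _ _)
    nlinarith [min_le_right 1 (a / 2)]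

/-- A set-wise bound of the exponential moment passes to predictable weights. -/
lemma CondSubGaussian.lintegral_mul_exp_le [IsProbabilityMeasure μ]
    (hm : m ≤ mΩ) {η : Ω → ℝ} (hη : CondSubGaussian μ m η) (hηm : Measurable η) (z : ℝ)
    {Y : Ω → ℝ≥0∞} (hY : Measurable[m] Y) :
    ∫⁻ ω, Y ω * ENNReal.ofReal (Real.exp (z * η ω)) ∂μ
      ≤ ENNReal.ofReal (Real.exp (z ^ 2 / 2)) * ∫⁻ ω, Y ω ∂μ := by
  have hg : Measurable fun ω => ENNReal.ofReal (Real.exp (z * η ω)) := by fun_prop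
  -- The set-wise bound is an inequality of measures on `m`, and integrating the `m`-measurable `Y`
  -- preserves it.
  have hle : (μ.withDensity fun ω => ENNReal.ofReal (Real.exp (z * η ω))).trim hm
      ≤ (ENNReal.ofReal (Real.exp (z ^ 2 / 2)) • μ).trim hm := by
    refine Measure.le_iff.2 fun B hB => ?_
    rw [trim_measurableSet_eq hm hB, trim_measurableSet_eq hm hB, withDensity_apply _ (hm B hB),
      Measure.smul_apply, smul_eq_mul]
    exact hη.setLIntegral_exp_le hm z hB
  have h := lintegral_mono' hle (le_refl Y)
  rw [lintegral_trim hm hY, lintegral_trim hm hY, lintegral_smul_measure,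
    lintegral_withDensity_eq_lintegral_mul _ hg (hY.mono hm le_rfl)] at h
  simpa [mul_comm] using h

/-- A Gaussian mixture of the exponentials `exp (η z - z² / 2)`, in closed form. -/
lemma lintegral_gaussianPDF_mul_exp (u η : ℝ) {v : ℝ≥0} (hv : v ≠ 0) :
    ∫⁻ z, gaussianPDF u v z * ENNReal.ofReal (Real.exp (z * η - z ^ 2 / 2)) =
      ENNReal.ofReal (Real.exp ((2 * η * u + η ^ 2 * v - u ^ 2) / (2 * (1 + v))) / √(1 + v)) := by
  have hv0 : (0 : ℝ) < v := by exact_mod_cast pos_iff_ne_zero.2 hv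
  have hw : v / (1 + v) ≠ 0 := by positivity
  -- Completing the square: the tilted density is a constant multiple of the Gaussian density with
  -- mean (u + ηv)/(1 + v) and variance v/(1 + v).
  have key : ∀ z, gaussianPDF u v z * ENNReal.ofReal (Real.exp (z * η - z ^ 2 / 2)) =
      ENNReal.ofReal (Real.exp ((2 * η * u + η ^ 2 * v - u ^ 2) / (2 * (1 + v))) / √(1 + v))
        * gaussianPDF ((u + η * v) / (1 + v)) (v / (1 + v)) z := by
    intro z
    rw [gaussianPDF, gaussianPDF, ← ENNReal.ofReal_mul (gaussianPDFReal_nonneg _ _ _),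
      ← ENNReal.ofReal_mul (by positivity)]
    congr 1
    rw [gaussianPDFReal, gaussianPDFReal]
    have h1 : √(2 * Real.pi * ((v / (1 + v) : ℝ≥0) : ℝ)) = √(2 * Real.pi * v) / √(1 + v) := by
      rw [← Real.sqrt_div (by positivity)]
      congr 1
      push_cast
      ring
    rw [h1, mul_assoc, ← Real.exp_add]
    have h2 : (√(2 * Real.pi * v) / √(1 + v))⁻¹ = (√(2 * Real.pi * v))⁻¹ * √(1 + v) := by
      rw [inv_div]; ring
    have h3 : √(1 + (v : ℝ)) ≠ 0 := by positivity
    rw [h2]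
    have h4 : -(z - u) ^ 2 / (2 * (v : ℝ)) + (z * η - z ^ 2 / 2)
        = (2 * η * u + η ^ 2 * v - u ^ 2) / (2 * (1 + v))
          + -(z - (u + η * v) / (1 + v)) ^ 2 / (2 * ((v / (1 + v) : ℝ≥0) : ℝ)) := by
      push_cast
      field_simp
      ring
    rw [h4, Real.exp_add]
    field_simp
  simp_rw [key]
  rw [lintegral_const_mul _ (measurable_gaussianPDF _ _), lintegral_gaussianPDF_eq_one _ hw, mul_one]

/-- One step of the method of mixtures: `u` and `q` are predictable, `η` is sub-Gaussian. -/
lemma lintegral_mul_mixture_step_le [SFinite μ] (hm : m ≤ mΩ)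
    {η : Ω → ℝ} (hηm : Measurable η)
    (hη : ∀ (z : ℝ) (Y : Ω → ℝ≥0∞), Measurable[m] Y →
      ∫⁻ ω, Y ω * ENNReal.ofReal (Real.exp (z * η ω)) ∂μ
        ≤ ENNReal.ofReal (Real.exp (z ^ 2 / 2)) * ∫⁻ ω, Y ω ∂μ)
    {u q : Ω → ℝ} (hu : Measurable[m] u) (hq : Measurable[m] q) (hq0 : ∀ ω, 0 ≤ q ω)
    (huq : ∀ ω, q ω = 0 → u ω = 0) {Y : Ω → ℝ≥0∞} (hY : Measurable[m] Y) :
    ∫⁻ ω, Y ω * ENNReal.ofReal (Real.exp ((2 * η ω * u ω + η ω ^ 2 * q ω - u ω ^ 2)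
      / (2 * (1 + q ω))) / √(1 + q ω)) ∂μ ≤ ∫⁻ ω, Y ω ∂μ := by
  -- Where q = 0 the Gaussian has no density. There u = 0 as well and the factor is 1, so this set
  -- is split off.
  have hZ : MeasurableSet[m] {ω | q ω = 0} := hq (measurableSet_singleton 0)
  rw [← lintegral_add_compl _ (hm _ hZ), ← lintegral_add_compl Y (hm _ hZ)]
  refine add_le_add ?_ ?_
  · refine (setLIntegral_congr_fun (hm _ hZ) fun ω hω => ?_).le
    have h1 : q ω = 0 := hω
    simp [h1, huq ω h1]
  let g : Ω → ℝ → ℝ≥0∞ := fun ω z => gaussianPDF (u ω) (q ω).toNNReal z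
  have hg : Measurable[m.prod inferInstance] (Function.uncurry g) :=
    measurable_uncurry_gaussianPDF.comp
      (Measurable.prodMk (hu.comp measurable_fst) (Measurable.prodMk
        (measurable_real_toNNReal.comp (hq.comp measurable_fst)) measurable_snd))
  have hg' : Measurable (Function.uncurry g) :=
    hg.mono (sup_le_sup (MeasurableSpace.comap_mono hm) le_rfl) le_rfl
  have hgz : ∀ z, Measurable[m] fun ω => g ω z := fun z =>
    hg.comp (Measurable.prodMk measurable_id measurable_const)
  let Y' : Ω → ℝ≥0∞ := {ω | q ω = 0}ᶜ.indicator Y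
  have hY' : Measurable[m] Y' := hY.indicator hZ.compl
  have hY'' : Measurable Y' := hY'.mono hm le_rfl
  have h1 : ∫⁻ ω in {ω | q ω = 0}ᶜ, Y ω * ENNReal.ofReal (Real.exp ((2 * η ω * u ω
      + η ω ^ 2 * q ω - u ω ^ 2) / (2 * (1 + q ω))) / √(1 + q ω)) ∂μ
      = ∫⁻ ω, (∫⁻ z, Y' ω * (g ω z * ENNReal.ofReal (Real.exp (z * η ω - z ^ 2 / 2)))) ∂μ := by
    rw [← lintegral_indicator (hm _ hZ.compl)]
    refine lintegral_congr fun ω => ?_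
    by_cases hω : q ω = 0
    · simp [Y', hω]
    · have hv : (q ω).toNNReal ≠ 0 := by
        simpa using lt_of_le_of_ne (hq0 ω) (Ne.symm hω)
      rw [lintegral_const_mul _ (by fun_prop), lintegral_gaussianPDF_mul_exp _ _ hv]
      simp [Y', hω, hq0 ω]
  have h2 : ∫⁻ ω in {ω | q ω = 0}ᶜ, Y ω ∂μ = ∫⁻ ω, (∫⁻ z, Y' ω * g ω z) ∂μ := by
    rw [← lintegral_indicator (hm _ hZ.compl)]
    refine lintegral_congr fun ω => ?_
    by_cases hω : q ω = 0
    · simp [Y', hω]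
    · have hv : (q ω).toNNReal ≠ 0 := by
        simpa using lt_of_le_of_ne (hq0 ω) (Ne.symm hω)
      rw [lintegral_const_mul _ (measurable_gaussianPDF _ _), lintegral_gaussianPDF_eq_one _ hv,
        mul_one]
  have hA1 : AEMeasurable (Function.uncurry fun ω z =>
      Y' ω * (g ω z * ENNReal.ofReal (Real.exp (z * η ω - z ^ 2 / 2)))) (μ.prod volume) := by
    refine ((hY''.comp measurable_fst).mul (hg'.mul ?_)).aemeasurable
    fun_prop
  have hA2 : AEMeasurable (Function.uncurry fun ω z => Y' ω * g ω z) (μ.prod volume) :=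
    ((hY''.comp measurable_fst).mul hg').aemeasurable
  -- After Tonelli z is fixed, and the Gaussian density at z becomes part of the predictable weight
  -- to which `hη` applies.
  rw [h1, h2, lintegral_lintegral_swap hA1, lintegral_lintegral_swap hA2]
  refine lintegral_mono fun z => ?_
  have h3 : ∀ ω, Y' ω * (g ω z * ENNReal.ofReal (Real.exp (z * η ω - z ^ 2 / 2)))
      = ENNReal.ofReal (Real.exp (-(z ^ 2 / 2)))
        * (Y' ω * g ω z * ENNReal.ofReal (Real.exp (z * η ω))) := by
    intro ω
    rw [sub_eq_add_neg, Real.exp_add, ENNReal.ofReal_mul (Real.exp_pos _).le]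
    ring
  simp_rw [h3]
  have hm1 : Measurable[m] fun ω => Y' ω * g ω z := hY'.mul (hgz z)
  rw [lintegral_const_mul' _ _ ENNReal.ofReal_ne_top]
  refine (mul_le_mul_right (hη z _ hm1) _).trans ?_
  rw [← mul_assoc, ← ENNReal.ofReal_mul (Real.exp_pos _).le, ← Real.exp_add]
  simp

/-- Ville's maximal inequality for a non-negative supermartingale with values in `[0, ∞]`. -/
lemma mul_measure_exists_le_of_supermartingale (F : Filtration ℕ mΩ) {W : ℕ → Ω → ℝ≥0∞}
    (hW : ∀ t, Measurable[F t] (W t))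
    (hstep : ∀ t B, MeasurableSet[F t] B → ∫⁻ ω in B, W (t + 1) ω ∂μ ≤ ∫⁻ ω in B, W t ω ∂μ)
    (K : ℝ≥0∞) (t : ℕ) :
    K * μ {ω | ∃ s < t, K ≤ W s ω} ≤ ∫⁻ ω, W 0 ω ∂μ := by
  let H : ℕ → Set Ω := fun t => {ω | ∃ s < t, K ≤ W s ω}
  have hlev : ∀ t, MeasurableSet[F t] {ω | K ≤ W t ω} := fun t => hW t measurableSet_Ici
  have hsucc : ∀ t, H (t + 1) = H t ∪ {ω | K ≤ W t ω} := by
    intro t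
    ext ω
    simp only [H, Set.mem_ofPred_eq, Set.mem_union, Nat.lt_succ_iff_lt_or_eq]
    constructor
    · rintro ⟨s, hs | rfl, h⟩
      · exact Or.inl ⟨s, hs, h⟩
      · exact Or.inr h
    · rintro (⟨s, hs, h⟩ | h)
      · exact ⟨s, Or.inl hs, h⟩
      · exact ⟨t, Or.inr rfl, h⟩
  have hH : ∀ t, MeasurableSet[F t] (H t) := by
    intro t
    induction t with
    | zero => simp [H]
    | succ t ih => rw [hsucc]; exact F.mono (Nat.le_succ t) _ (ih.union (hlev t))
  -- Strengthened for the induction: the second term is the mass of the process on paths that have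
  -- not yet reached level `K`. It pays for the paths that reach it next.
  suffices h : K * μ (H t) + ∫⁻ ω in (H t)ᶜ, W t ω ∂μ ≤ ∫⁻ ω, W 0 ω ∂μ from
    le_self_add.trans h
  induction t with
  | zero => simp [H]
  | succ t ih =>
    have hm1 : MeasurableSet[F t] (H (t + 1)) := by rw [hsucc]; exact (hH t).union (hlev t)
    have hE : MeasurableSet {ω | K ≤ W t ω} := F.le t _ (hlev t)
    have hsplit : ∫⁻ ω in (H t)ᶜ, W t ω ∂μ = ∫⁻ ω in (H t)ᶜ ∩ {ω | K ≤ W t ω}, W t ω ∂μ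
        + ∫⁻ ω in (H (t + 1))ᶜ, W t ω ∂μ := by
      rw [← lintegral_inter_add_sdiff _ _ hE, hsucc, Set.compl_union, Set.sdiff_eq]
    have hK : K * μ ((H t)ᶜ ∩ {ω | K ≤ W t ω}) ≤ ∫⁻ ω in (H t)ᶜ ∩ {ω | K ≤ W t ω}, W t ω ∂μ := by
      rw [← setLIntegral_const]
      exact setLIntegral_mono ((hW t).mono (F.le t) le_rfl) fun ω hω => hω.2
    have hμ : μ (H (t + 1)) ≤ μ (H t) + μ ((H t)ᶜ ∩ {ω | K ≤ W t ω}) := by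
      refine (measure_mono fun ω hω => ?_).trans (measure_union_le _ _)
      rw [hsucc] at hω
      by_cases h : ω ∈ H t
      · exact Or.inl h
      · exact Or.inr ⟨h, hω.resolve_left h⟩
    calc K * μ (H (t + 1)) + ∫⁻ ω in (H (t + 1))ᶜ, W (t + 1) ω ∂μ
        ≤ K * (μ (H t) + μ ((H t)ᶜ ∩ {ω | K ≤ W t ω})) + ∫⁻ ω in (H (t + 1))ᶜ, W t ω ∂μ := by
          exact add_le_add (mul_le_mul_right hμ _) (hstep t _ hm1.compl)
      _ ≤ K * μ (H t) + (∫⁻ ω in (H t)ᶜ ∩ {ω | K ≤ W t ω}, W t ω ∂μ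
          + ∫⁻ ω in (H (t + 1))ᶜ, W t ω ∂μ) := by
          rw [mul_add, add_assoc]
          gcongr
      _ ≤ _ := by rw [← hsplit]; exact ih

end SubGaussian

/-! ### The ridge estimator on one sample path -/

section Ridge

variable {d : ℕ} {lam : ℝ}

lemma wnorm_nonneg (A : Matrix (Fin d) (Fin d) ℝ) (v : Feature d) : 0 ≤ wnorm A v :=
  Real.sqrt_nonneg _

lemma abs_dotProduct_inv_mulVec_le {A : Matrix (Fin d) (Fin d) ℝ} (hA : A.PosDef)
    (u v : Feature d) :
    |u.ofLp ⬝ᵥ A⁻¹.mulVec v.ofLp| ≤ wnorm A⁻¹ u * wnorm A⁻¹ v := by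
  rw [wnorm, wnorm, ← Real.sqrt_mul (dotProduct_inv_mulVec_nonneg hA _)]
  exact Real.abs_le_sqrt (sq_dotProduct_inv_mulVec_le hA _ _)

lemma wnorm_gram_inv_le (hlam : 0 < lam) (X : ℕ → Feature d) (t : ℕ) (v : Feature d) :
    wnorm (gram lam X t)⁻¹ v ≤ ‖v‖ / √lam := by
  rw [wnorm]
  refine (Real.sqrt_le_sqrt (dotProduct_gram_inv_mulVec_le hlam X t v)).trans_eq ?_
  rw [Real.sqrt_div (by positivity), Real.sqrt_sq (norm_nonneg v)]

lemma bvec_succ (X : ℕ → Feature d) (R : ℕ → ℝ) (t : ℕ) :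
    (bvec X R (t + 1)).ofLp = (bvec X R t).ofLp + R t • (X t).ofLp := by
  simp [bvec, Finset.sum_range_succ]

lemma inner_eq_dotProduct (u v : Feature d) : inner ℝ u v = v.ofLp ⬝ᵥ u.ofLp := by
  simp [EuclideanSpace.inner_eq_star_dotProduct]

/-- Each payoff contributes its noise and the vector x xᵀ θ. The latter sum to (A_t - λ I) θ, and
the term -λ θ becomes the regularization bias of the estimator. -/
lemma bvec_eq_noise_add (X : ℕ → Feature d) (R E : ℕ → ℝ) (θ : Feature d)
    (hR : ∀ s, R s = inner ℝ θ (X s) + E s) (t : ℕ) :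
    (bvec X R t).ofLp
      = (bvec X E t).ofLp + (gram lam X t).mulVec θ.ofLp - lam • θ.ofLp := by
  induction t with
  | zero => simp [bvec, gram_zero, Matrix.smul_mulVec]
  | succ t ih =>
    rw [bvec_succ, bvec_succ, gram_succ, Matrix.add_mulVec, Matrix.vecMulVec_mulVec, ih, hR,
      inner_eq_dotProduct]
    ext i
    simp
    ring

lemma ridge_ofLp_eq (hlam : 0 < lam) (X : ℕ → Feature d) (R E : ℕ → ℝ) (θ : Feature d)
    (hR : ∀ s, R s = inner ℝ θ (X s) + E s) (t : ℕ) :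
    (ridge lam X R t).ofLp = θ.ofLp + (gram lam X t)⁻¹.mulVec (bvec X E t).ofLp
      - lam • (gram lam X t)⁻¹.mulVec θ.ofLp := by
  have hA := gram_posDef hlam X t
  rw [ridge, bvec_eq_noise_add (lam := lam) X R E θ hR, Matrix.mulVec_sub, Matrix.mulVec_add,
    inv_mulVec_mulVec hA, Matrix.mulVec_smul, add_comm θ.ofLp]

/-- The mixture process `(|λ I| / |A_t|)^{1/2} exp(‖S_t‖²_{A_t⁻¹} / 2)` with `S_t = ∑_{s<t} E_s x_s`. -/
noncomputable def mixture (lam : ℝ) (X : ℕ → Feature d) (E : ℕ → ℝ) (t : ℕ) : ℝ :=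
  √(lam ^ d / (gram lam X t).det)
    * Real.exp ((bvec X E t).ofLp ⬝ᵥ (gram lam X t)⁻¹.mulVec (bvec X E t).ofLp / 2)

lemma mixture_zero (hlam : 0 < lam) (X : ℕ → Feature d) (E : ℕ → ℝ) : mixture lam X E 0 = 1 := by
  simp [mixture, bvec, gram_zero, hlam.ne']

/-- The factor has exactly the form of `lintegral_gaussianPDF_mul_exp`, with mean u = xᵀ A⁻¹ S and
variance q = xᵀ A⁻¹ x. -/
lemma mixture_succ (hlam : 0 < lam) (X : ℕ → Feature d) (E : ℕ → ℝ) (t : ℕ) :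
    mixture lam X E (t + 1) = mixture lam X E t *
      (Real.exp ((2 * E t * ((X t).ofLp ⬝ᵥ (gram lam X t)⁻¹.mulVec (bvec X E t).ofLp)
        + E t ^ 2 * ((X t).ofLp ⬝ᵥ (gram lam X t)⁻¹.mulVec (X t).ofLp)
        - ((X t).ofLp ⬝ᵥ (gram lam X t)⁻¹.mulVec (bvec X E t).ofLp) ^ 2)
        / (2 * (1 + (X t).ofLp ⬝ᵥ (gram lam X t)⁻¹.mulVec (X t).ofLp)))
        / √(1 + (X t).ofLp ⬝ᵥ (gram lam X t)⁻¹.mulVec (X t).ofLp)) := by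
  have hA := gram_posDef hlam X t
  have hq := dotProduct_inv_mulVec_nonneg hA (X t).ofLp
  have hpos := hA.det_pos
  rw [mixture, mixture, bvec_succ, gram_succ, dotProduct_inv_add_vecMulVec_mulVec hA,
    det_add_vecMulVec hA, ← div_div, Real.sqrt_div (by positivity), add_div, Real.exp_add, div_div,
    mul_comm _ (2 : ℝ)]
  ring

/-- Where the mixture process is below `1 / δ`, the ridge estimator predicts up to the confidence
radius times the width. -/
lemma abs_inner_ridge_sub_le (hlam : 0 < lam) {δ : ℝ} (X : ℕ → Feature d)
    (R E : ℕ → ℝ) (θ : Feature d) (hR : ∀ s, R s = inner ℝ θ (X s) + E s) {t : ℕ}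
    (hmix : mixture lam X E t < δ⁻¹) (x : Feature d) :
    |inner ℝ (ridge lam X R t) x - inner ℝ θ x|
      ≤ confRadius lam δ θ X t * wnorm (gram lam X t)⁻¹ x := by
  have hA := gram_posDef hlam X t
  have hpos := hA.det_pos
  set A := gram lam X t with hAdef
  have hS : wnorm A⁻¹ (bvec X E t)
      ≤ √(2 * Real.log (√A.det * (√(lam • (1 : Matrix (Fin d) (Fin d) ℝ)).det)⁻¹ * δ⁻¹)) := by
    refine Real.sqrt_le_sqrt ?_
    rw [mixture, ← hAdef] at hmix
    have hdet : (lam • (1 : Matrix (Fin d) (Fin d) ℝ)).det = lam ^ d := by simp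
    have h1 : Real.exp ((bvec X E t).ofLp ⬝ᵥ A⁻¹.mulVec (bvec X E t).ofLp / 2)
        ≤ √A.det * (√(lam ^ d))⁻¹ * δ⁻¹ := by
      have h2 : √A.det * (√(lam ^ d))⁻¹ * √(lam ^ d / A.det) = 1 := by
        rw [Real.sqrt_div (by positivity)]
        field_simp
      calc _ = √A.det * (√(lam ^ d))⁻¹ * (√(lam ^ d / A.det)
            * Real.exp ((bvec X E t).ofLp ⬝ᵥ A⁻¹.mulVec (bvec X E t).ofLp / 2)) := by
              rw [← mul_assoc, h2, one_mul]
        _ ≤ _ := by gcongr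
    have h3 := (Real.le_log_iff_exp_le ((Real.exp_pos _).trans_le h1)).2 h1
    rw [hdet]
    linarith
  -- The bias contributes the first summand of the radius, `hS` the second.
  have hθ : lam * wnorm A⁻¹ θ ≤ √lam * ‖θ‖ := by
    calc lam * wnorm A⁻¹ θ ≤ lam * (‖θ‖ / √lam) := by
          gcongr
          exact wnorm_gram_inv_le hlam X t θ
      _ = √lam * ‖θ‖ := by
          have h : 0 < √lam := Real.sqrt_pos.2 hlam
          field_simp
          rw [Real.sq_sqrt hlam.le, mul_comm]
  have heq : inner ℝ (ridge lam X R t) x - inner ℝ θ x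
      = x.ofLp ⬝ᵥ A⁻¹.mulVec (bvec X E t).ofLp - lam * (x.ofLp ⬝ᵥ A⁻¹.mulVec θ.ofLp) := by
    rw [inner_eq_dotProduct, inner_eq_dotProduct, ridge_ofLp_eq hlam X R E θ hR]
    simp only [dotProduct_add, dotProduct_sub, dotProduct_smul, smul_eq_mul, ← hAdef]
    ring
  have h1 := abs_dotProduct_inv_mulVec_le hA x (bvec X E t)
  have h2 := abs_dotProduct_inv_mulVec_le hA x θ
  have hx := wnorm_nonneg A⁻¹ x
  rw [heq, confRadius]
  calc _ ≤ |x.ofLp ⬝ᵥ A⁻¹.mulVec (bvec X E t).ofLp| + |lam * (x.ofLp ⬝ᵥ A⁻¹.mulVec θ.ofLp)| :=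
        abs_sub _ _
    _ ≤ wnorm A⁻¹ x * wnorm A⁻¹ (bvec X E t) + lam * (wnorm A⁻¹ x * wnorm A⁻¹ θ) := by
        rw [abs_mul, abs_of_pos hlam]
        gcongr
    _ = (lam * wnorm A⁻¹ θ + wnorm A⁻¹ (bvec X E t)) * wnorm A⁻¹ x := by ring
    _ ≤ _ := by gcongr

end Ridge

/-! ### Measurability -/

section Measurability

variable {Ω : Type*} {mΩ : MeasurableSpace Ω} {d : ℕ}

lemma measurable_select {Arm β : Type*} [Countable Arm] [MeasurableSpace β] {sel : Ω → Arm}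
    (hsel : ∀ a, MeasurableSet {ω | sel ω = a}) {f : Arm → Ω → β} (hf : ∀ a, Measurable (f a)) :
    Measurable fun ω => f (sel ω) ω := by
  intro s hs
  have : (fun ω => f (sel ω) ω) ⁻¹' s = ⋃ a, {ω | sel ω = a} ∩ f a ⁻¹' s := by
    ext ω
    simp
  rw [this]
  exact MeasurableSet.iUnion fun a => (hsel a).inter (hf a hs)

lemma measurable_det {n : Type*} [Fintype n] [DecidableEq n] {A : Ω → Matrix n n ℝ}
    (hA : ∀ i j, Measurable fun ω => A ω i j) : Measurable fun ω => (A ω).det := by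
  simp only [Matrix.det_apply']
  exact Finset.measurable_sum _ fun σ _ =>
    (Finset.measurable_prod _ fun i _ => hA _ _).const_mul _

/-- By Cramer's rule the entries are quotients of determinants. The inverse of a singular matrix is
`0` by convention, which agrees with the formula, so invertibility is not required. -/
lemma measurable_inv_apply {n : Type*} [Fintype n] [DecidableEq n] {A : Ω → Matrix n n ℝ}
    (hA : ∀ i j, Measurable fun ω => A ω i j) (i j : n) :
    Measurable fun ω => (A ω)⁻¹ i j := by
  simp only [Matrix.inv_def, Matrix.smul_apply, Ring.inverse_eq_inv', smul_eq_mul,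
    Matrix.adjugate_apply]
  refine (measurable_det hA).inv.mul (measurable_det fun k l => ?_)
  simp only [Matrix.updateRow_apply]
  split_ifs
  · exact measurable_const
  · exact hA _ _

lemma measurable_dotProduct_mulVec {n : Type*} [Fintype n] {A : Ω → Matrix n n ℝ}
    {u v : Ω → n → ℝ} (hA : ∀ i j, Measurable fun ω => A ω i j)
    (hu : ∀ i, Measurable fun ω => u ω i) (hv : ∀ i, Measurable fun ω => v ω i) :
    Measurable fun ω => u ω ⬝ᵥ (A ω).mulVec (v ω) := by
  simp only [dotProduct, Matrix.mulVec]
  exact Finset.measurable_sum _ fun i _ => (hu i).mul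
    (Finset.measurable_sum _ fun j _ => (hA i j).mul (hv j))

variable {lam : ℝ} {X : Ω → ℕ → Feature d} {E : Ω → ℕ → ℝ}

lemma measurable_gram_apply {t : ℕ} (hX : ∀ s < t, ∀ i, Measurable fun ω => (X ω s).ofLp i)
    (i j : Fin d) : Measurable fun ω => gram lam (X ω) t i j := by
  simp only [gram, Matrix.add_apply, Matrix.sum_apply, Matrix.vecMulVec_apply]
  refine measurable_const.add (Finset.measurable_sum _ fun s hs => ?_)
  exact (hX s (Finset.mem_range.1 hs) i).mul (hX s (Finset.mem_range.1 hs) j)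

lemma measurable_bvec_apply {t : ℕ} (hX : ∀ s < t, ∀ i, Measurable fun ω => (X ω s).ofLp i)
    (hE : ∀ s < t, Measurable fun ω => E ω s) (i : Fin d) :
    Measurable fun ω => (bvec (X ω) (E ω) t).ofLp i := by
  simp only [bvec, WithLp.ofLp_sum, WithLp.ofLp_smul, Finset.sum_apply, Pi.smul_apply, smul_eq_mul]
  exact Finset.measurable_sum _ fun s hs =>
    (hE s (Finset.mem_range.1 hs)).mul (hX s (Finset.mem_range.1 hs) i)

lemma measurable_mixture {t : ℕ} (hX : ∀ s < t, ∀ i, Measurable fun ω => (X ω s).ofLp i)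
    (hE : ∀ s < t, Measurable fun ω => E ω s) :
    Measurable fun ω => mixture lam (X ω) (E ω) t := by
  simp only [mixture]
  have hG := measurable_gram_apply (lam := lam) hX
  have hb := measurable_bvec_apply hX hE
  exact ((measurable_const.div (measurable_det hG)).sqrt).mul
    ((measurable_dotProduct_mulVec (measurable_inv_apply hG) hb hb).div_const 2).exp

end Measurability

lemma eq_sum_indicator {Arm Ω : Type*} [Fintype Arm] (sel : Ω → Arm) (f : Arm → Ω → ℝ) :
    (fun ω => f (sel ω) ω) = fun ω => ∑ a, {ω | sel ω = a}.indicator (f a) ω := by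
  classical
  funext ω
  rw [Finset.sum_eq_single (sel ω)]
  · simp
  · intro a _ ha
    simp [Ne.symm ha]
  · simp

namespace Bandit

open scoped ENNReal

variable {d : ℕ} {Arm Ω : Type*} [mΩ : MeasurableSpace Ω] {B : Bandit d Arm Ω} {μ : Measure Ω}
  {L M lam : ℝ} {arm best : ℕ → Ω → Arm}

/-! ### The noise along a predictable selection of arms -/

/-- The noise of the arms pulled on the sample path `ω`. -/
noncomputable def pulledNoise (B : Bandit d Arm Ω) (arm : ℕ → Ω → Arm) (ω : Ω) (s : ℕ) : ℝ :=
  B.noise s (arm s ω) ω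

lemma payoff_eq (B : Bandit d Arm Ω) (arm : ℕ → Ω → Arm) (ω : Ω) (s : ℕ) :
    B.payoff arm ω s = inner ℝ B.θ (B.pulledX arm ω s) + B.pulledNoise arm ω s := by
  simp [payoff, pulledNoise, noise, mean, pulledX]

lemma Assumptions.measurable_mean (h : B.Assumptions μ L M) (t : ℕ) (a : Arm) :
    Measurable[B.F t] (B.mean t a) :=
  (measurable_const (a := B.θ)).inner (h.x_predictable t a)

lemma Assumptions.measurable_noise (h : B.Assumptions μ L M) (t : ℕ) (a : Arm) :
    Measurable (B.noise t a) :=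
  (h.reward_measurable t a).sub ((h.measurable_mean t a).mono (B.F.le t) le_rfl)

lemma Assumptions.measurable_pulledX [Finite Arm] (h : B.Assumptions μ L M)
    (harm : B.Predictable arm) (t : ℕ) : Measurable[B.F t] fun ω => B.pulledX arm ω t :=
  measurable_select (mΩ := B.F t) (harm t) (h.x_predictable t)

lemma Assumptions.measurable_pulledX_apply [Finite Arm] (h : B.Assumptions μ L M)
    (harm : B.Predictable arm) {s t : ℕ} (hst : s ≤ t) (i : Fin d) :
    Measurable[B.F t] fun ω => (B.pulledX arm ω s).ofLp i := by
  have h1 : Measurable fun v : Feature d => v.ofLp i := by fun_prop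
  exact h1.comp ((h.measurable_pulledX harm s).mono (B.F.mono hst) le_rfl)

lemma Assumptions.measurable_pulledNoise [Finite Arm] (h : B.Assumptions μ L M)
    (harm : B.Predictable arm)
    (hobs : ∀ t, Measurable[B.F (t + 1)] fun ω => B.payoff arm ω t) {s t : ℕ} (hst : s < t) :
    Measurable[B.F t] fun ω => B.pulledNoise arm ω s := by
  have h1 : (fun ω => B.pulledNoise arm ω s)
      = fun ω => B.payoff arm ω s - inner ℝ B.θ (B.pulledX arm ω s) := by
    funext ω
    rw [payoff_eq]
    ring
  rw [h1]
  exact ((hobs s).mono (B.F.mono hst) le_rfl).sub ((measurable_const (a := B.θ)).inner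
    ((h.measurable_pulledX harm s).mono (B.F.mono hst.le) le_rfl))

/-- The noise of a predictably selected arm has sub-Gaussian exponential moments. -/
lemma Assumptions.lintegral_mul_exp_pulledNoise_le [Finite Arm] [IsProbabilityMeasure μ]
    (h : B.Assumptions μ L M) (harm : B.Predictable arm) (t : ℕ) (z : ℝ) {Y : Ω → ℝ≥0∞}
    (hY : Measurable[B.F t] Y) :
    ∫⁻ ω, Y ω * ENNReal.ofReal (Real.exp (z * B.pulledNoise arm ω t)) ∂μ
      ≤ ENNReal.ofReal (Real.exp (z ^ 2 / 2)) * ∫⁻ ω, Y ω ∂μ := by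
  classical
  have : Fintype Arm := Fintype.ofFinite Arm
  have hYa : ∀ a, Measurable[B.F t] ({ω | arm t ω = a}.indicator Y) := fun a =>
    hY.indicator (harm t a)
  -- The sub-Gaussian assumption concerns fixed arms. Splitting according to the pulled arm leaves
  -- predictable weights, since the selection is predictable.
  have hsplit : ∀ g : Arm → Ω → ℝ≥0∞, (∀ a, Measurable (g a)) →
      ∫⁻ ω, Y ω * g (arm t ω) ω ∂μ
        = ∑ a, ∫⁻ ω, {ω | arm t ω = a}.indicator Y ω * g a ω ∂μ := by
    intro g hg
    have hm : ∀ a, Measurable fun ω => {ω | arm t ω = a}.indicator Y ω * g a ω := fun a =>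
      ((hYa a).mono (B.F.le t) le_rfl).mul (hg a)
    rw [← lintegral_finsetSum _ fun a _ => hm a]
    refine lintegral_congr fun ω => ?_
    rw [Finset.sum_eq_single (arm t ω)]
    · simp
    · intro a _ ha
      simp [Ne.symm ha]
    · simp
  have h1 := hsplit (fun _ _ => 1) fun _ => measurable_const
  simp only [mul_one] at h1
  rw [h1, Finset.mul_sum]
  refine (hsplit (fun a ω => ENNReal.ofReal (Real.exp (z * B.noise t a ω))) fun a =>
    ((h.measurable_noise t a).const_mul z).exp.ennreal_ofReal).trans_le ?_
  exact Finset.sum_le_sum fun a _ => (h.noise_subGaussian t a).lintegral_mul_exp_le (B.F.le t)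
    (h.measurable_noise t a) z (hYa a)

lemma Assumptions.measurable_mixture [Finite Arm] (h : B.Assumptions μ L M)
    (harm : B.Predictable arm)
    (hobs : ∀ t, Measurable[B.F (t + 1)] fun ω => B.payoff arm ω t) (t : ℕ) :
    Measurable[B.F t] fun ω => mixture lam (B.pulledX arm ω) (B.pulledNoise arm ω) t :=
  FairLinUCB.measurable_mixture (mΩ := B.F t)
    (fun _ hs i => h.measurable_pulledX_apply harm hs.le i)
    fun _ hs => h.measurable_pulledNoise harm hobs hs

/-- The self-normalized bound: with probability at least `1 - 1 / K` the mixture process stays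
below `K`. -/
lemma Assumptions.measureReal_mixture_ge_le [Finite Arm] [IsProbabilityMeasure μ]
    (h : B.Assumptions μ L M) (hlam : 0 < lam) (harm : B.Predictable arm)
    (hobs : ∀ t, Measurable[B.F (t + 1)] fun ω => B.payoff arm ω t) {K : ℝ} (hK : 0 < K) (t : ℕ) :
    μ.real {ω | ∃ s < t, K ≤ mixture lam (B.pulledX arm ω) (B.pulledNoise arm ω) s} ≤ 1 / K := by
  have hmix := fun t => h.measurable_mixture (lam := lam) harm hobs t
  have hnn : ∀ s ω, 0 ≤ mixture lam (B.pulledX arm ω) (B.pulledNoise arm ω) s := fun s ω => by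
    rw [mixture]; positivity
  have hv := mul_measure_exists_le_of_supermartingale (μ := μ) B.F
    (W := fun t ω => ENNReal.ofReal (mixture lam (B.pulledX arm ω) (B.pulledNoise arm ω) t))
    (fun t => (hmix t).ennreal_ofReal) ?_ (ENNReal.ofReal K) t
  · simp only [mixture_zero hlam, ENNReal.ofReal_one, lintegral_const, measure_univ, mul_one,
      ENNReal.ofReal_le_ofReal_iff (hnn _ _)] at hv
    have := ENNReal.toReal_mono ENNReal.one_ne_top hv
    rw [ENNReal.toReal_mul, ENNReal.toReal_ofReal hK.le, ENNReal.toReal_one] at this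
    rw [le_div_iff₀ hK, mul_comm]
    exact this
  intro t S hS
  have hG := measurable_gram_apply (mΩ := B.F t) (lam := lam) (X := B.pulledX arm) (t := t)
    fun _ hs i => h.measurable_pulledX_apply harm hs.le i
  have hA := measurable_inv_apply (mΩ := B.F t) hG
  have hx := fun i => h.measurable_pulledX_apply harm (le_refl t) i
  have hb := measurable_bvec_apply (mΩ := B.F t) (X := B.pulledX arm) (E := B.pulledNoise arm)
    (fun _ hs i => h.measurable_pulledX_apply harm hs.le i)
    fun _ hs => h.measurable_pulledNoise harm hobs hs
  have hP := fun ω => gram_posDef hlam (B.pulledX arm ω) t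
  have hstep := lintegral_mul_mixture_step_le (μ := μ) (B.F.le t)
    ((h.measurable_pulledNoise harm hobs (Nat.lt_succ_self t)).mono (B.F.le _) le_rfl)
    (fun z Y hY => h.lintegral_mul_exp_pulledNoise_le harm t z hY)
    (measurable_dotProduct_mulVec (mΩ := B.F t) hA hx hb)
    (measurable_dotProduct_mulVec (mΩ := B.F t) hA hx hx)
    (fun ω => dotProduct_inv_mulVec_nonneg (hP ω) _)
    -- Cauchy–Schwarz for A_t⁻¹: if the pulled feature has zero norm, its product with S_t vanishes.
    (fun ω hω => by
      have := sq_dotProduct_inv_mulVec_le (hP ω) (B.pulledX arm ω t).ofLp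
        (bvec (B.pulledX arm ω) (B.pulledNoise arm ω) t).ofLp
      rw [hω, zero_mul] at this
      exact pow_eq_zero_iff two_ne_zero |>.1 (le_antisymm this (sq_nonneg _)))
    (((hmix t).ennreal_ofReal).indicator hS)
  rw [← lintegral_indicator (B.F.le t _ hS), ← lintegral_indicator (B.F.le t _ hS)]
  refine le_trans (le_of_eq (lintegral_congr fun ω => ?_)) hstep
  by_cases hω : ω ∈ S
  · simp only [Set.indicator_of_mem hω]
    rw [mixture_succ hlam, ENNReal.ofReal_mul (hnn t ω)]
  · simp [hω]

/-! ### The mean rewards -/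

lemma Assumptions.abs_mean_le (h : B.Assumptions μ L M) (t : ℕ) (a : Arm) (ω : Ω) :
    |B.mean t a ω| ≤ ‖B.θ‖ * L :=
  (abs_real_inner_le_norm _ _).trans
    (mul_le_mul_of_nonneg_left (h.norm_x_lt t a ω).le (norm_nonneg _))

lemma Assumptions.integrable_mean [IsFiniteMeasure μ] (h : B.Assumptions μ L M) (t : ℕ) (a : Arm) :
    Integrable (B.mean t a) μ :=
  Integrable.of_bound ((h.measurable_mean t a).mono (B.F.le t) le_rfl).aestronglyMeasurable
    (‖B.θ‖ * L) (Filter.Eventually.of_forall fun ω => h.abs_mean_le t a ω)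

lemma Assumptions.integrable_reward [IsFiniteMeasure μ] (h : B.Assumptions μ L M) (t : ℕ)
    (a : Arm) : Integrable (B.reward t a) μ := by
  refine Integrable.of_bound (h.reward_measurable t a).aestronglyMeasurable 1 ?_
  filter_upwards [h.reward_mem t a] with ω hω
  rw [Real.norm_eq_abs, abs_of_nonneg hω.1]
  exact hω.2

lemma Assumptions.integrable_noise [IsFiniteMeasure μ] (h : B.Assumptions μ L M) (t : ℕ)
    (a : Arm) : Integrable (B.noise t a) μ :=
  (h.integrable_reward t a).sub (h.integrable_mean t a)

lemma Assumptions.mean_ae_eq_condExp [IsProbabilityMeasure μ] (h : B.Assumptions μ L M) (t : ℕ)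
    (a : Arm) : B.mean t a =ᵐ[μ] μ[B.reward t a|B.F t] := by
  refine ae_eq_condExp_of_forall_setIntegral_eq (B.F.le t) (h.integrable_reward t a)
    (fun _ _ _ => (h.integrable_mean t a).integrableOn) (fun S hS _ => ?_)
    (h.measurable_mean t a).aestronglyMeasurable
  have h0 := (h.noise_subGaussian t a).setIntegral_eq_zero (B.F.le t) (h.integrable_noise t a) hS
  have h1 : ∫ ω in S, B.noise t a ω ∂μ
      = ∫ ω in S, B.reward t a ω ∂μ - ∫ ω in S, B.mean t a ω ∂μ :=
    integral_sub (h.integrable_reward t a).integrableOn (h.integrable_mean t a).integrableOn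
  linarith

/-- The mean is a conditional expectation of a reward in [0, 1]. This is what limits the loss of a
single round to 1, almost surely. -/
lemma Assumptions.mean_mem_Icc [IsProbabilityMeasure μ] (h : B.Assumptions μ L M) (t : ℕ)
    (a : Arm) : ∀ᵐ ω ∂μ, B.mean t a ω ∈ Set.Icc (0 : ℝ) 1 := by
  have h0 : (0 : Ω → ℝ) ≤ᵐ[μ] μ[B.reward t a|B.F t] :=
    condExp_nonneg ((h.reward_mem t a).mono fun ω hω => hω.1)
  have h1 : μ[B.reward t a|B.F t] ≤ᵐ[μ] μ[fun _ => (1 : ℝ)|B.F t] :=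
    condExp_mono (h.integrable_reward t a) (integrable_const 1)
      ((h.reward_mem t a).mono fun ω hω => hω.2)
  rw [condExp_const (B.F.le t)] at h1
  filter_upwards [h.mean_ae_eq_condExp t a, h0, h1] with ω he h0 h1
  rw [he]
  exact ⟨h0, h1⟩

lemma Predictable.integrable_select [Finite Arm] {sel : ℕ → Ω → Arm} (hsel : B.Predictable sel)
    (t : ℕ) {f : Arm → Ω → ℝ} (hf : ∀ a, Integrable (f a) μ) :
    Integrable (fun ω => f (sel t ω) ω) μ := by
  have : Fintype Arm := Fintype.ofFinite Arm
  rw [eq_sum_indicator]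
  exact integrable_finsetSum _ fun a _ => (hf a).indicator (B.F.le t _ (hsel t a))

/-- The noise integrates to zero on each event that a given arm is selected, because that event is
known before the reward. -/
lemma Assumptions.integral_reward_select [Finite Arm] [IsProbabilityMeasure μ]
    (h : B.Assumptions μ L M) {sel : ℕ → Ω → Arm} (hsel : B.Predictable sel) (t : ℕ) :
    ∫ ω, B.reward t (sel t ω) ω ∂μ = ∫ ω, B.mean t (sel t ω) ω ∂μ := by
  have : Fintype Arm := Fintype.ofFinite Arm
  have h0 : ∫ ω, B.noise t (sel t ω) ω ∂μ = 0 := by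
    rw [eq_sum_indicator, integral_finsetSum _ fun a _ =>
      (h.integrable_noise t a).indicator (B.F.le t _ (hsel t a))]
    refine Finset.sum_eq_zero fun a _ => ?_
    rw [integral_indicator (B.F.le t _ (hsel t a))]
    exact (h.noise_subGaussian t a).setIntegral_eq_zero (B.F.le t) (h.integrable_noise t a)
      (hsel t a)
  have h1 : ∫ ω, B.noise t (sel t ω) ω ∂μ
      = ∫ ω, B.reward t (sel t ω) ω ∂μ - ∫ ω, B.mean t (sel t ω) ω ∂μ :=
    integral_sub (hsel.integrable_select t (h.integrable_reward t))
      (hsel.integrable_select t (h.integrable_mean t))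
  linarith

lemma Assumptions.integrable_mean_sub [Finite Arm] [IsProbabilityMeasure μ]
    (h : B.Assumptions μ L M) (hbest : B.Predictable best) (harm : B.Predictable arm) (t : ℕ) :
    Integrable (fun ω => B.mean t (best t ω) ω - B.mean t (arm t ω) ω) μ :=
  (hbest.integrable_select t (h.integrable_mean t)).sub
    (harm.integrable_select t (h.integrable_mean t))

lemma Assumptions.integrable_regret [Finite Arm] [IsProbabilityMeasure μ]
    (h : B.Assumptions μ L M) (hbest : B.Predictable best) (harm : B.Predictable arm) (T : ℕ) :
    Integrable (B.regret best arm T) μ :=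
  integrable_finsetSum _ fun t _ => h.integrable_mean_sub hbest harm t

lemma Assumptions.expectedRegret_eq [Finite Arm] [IsProbabilityMeasure μ]
    (h : B.Assumptions μ L M) (hbest : B.Predictable best) (harm : B.Predictable arm) (T : ℕ) :
    B.expectedRegret μ best arm T = ∫ ω, B.regret best arm T ω ∂μ := by
  have hr := fun {sel : ℕ → Ω → Arm} (hs : B.Predictable sel) t =>
    hs.integrable_select t (h.integrable_reward t)
  have hm := fun {sel : ℕ → Ω → Arm} (hs : B.Predictable sel) t =>
    hs.integrable_select t (h.integrable_mean t)
  simp only [expectedRegret, regret]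
  rw [integral_finsetSum _ fun t _ => hr hbest t, integral_finsetSum _ fun t _ => hr harm t,
    integral_finsetSum _ fun t _ => h.integrable_mean_sub hbest harm t, ← Finset.sum_sub_distrib]
  refine Finset.sum_congr rfl fun t _ => ?_
  rw [integral_sub (hm hbest t) (hm harm t), h.integral_reward_select hbest,
    h.integral_reward_select harm]

end Bandit

namespace Bandit

variable {d : ℕ} {Arm Ω : Type*} [mΩ : MeasurableSpace Ω] {B : Bandit d Arm Ω} {μ : Measure Ω}
  {L M lam γ : ℝ} {α : ℕ → Ω → ℝ} {arm best : ℕ → Ω → Arm}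

/-! ### The regret on one sample path -/

lemma meanPayoff_mem_Icc {ω : Ω} (hpay : ∀ s, B.payoff arm ω s ∈ Set.Icc (0 : ℝ) 1) (t : ℕ)
    (P : ℕ → Prop) : B.meanPayoff arm ω t P ∈ Set.Icc (0 : ℝ) 1 := by
  classical
  rw [meanPayoff]
  refine ⟨div_nonneg (Finset.sum_nonneg fun s _ => (hpay s).1) (Nat.cast_nonneg _),
    div_le_one_of_le₀ ?_ (Nat.cast_nonneg _)⟩
  simpa using Finset.sum_le_card_nsmul _ (fun s => B.payoff arm ω s) 1 fun s _ => (hpay s).2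

lemma abs_penalty_le_one {ω : Ω} (hpay : ∀ s, B.payoff arm ω s ∈ Set.Icc (0 : ℝ) 1) (t : ℕ)
    (a : Arm) : |B.penalty arm t a ω| ≤ 1 := by
  have hd : |B.armGroupMean arm t a ω true - B.armGroupMean arm t a ω false| ≤ 1 := by
    have h1 := meanPayoff_mem_Icc hpay t fun s => B.privileged s ω = true ∧ arm s ω = a
    have h2 := meanPayoff_mem_Icc hpay t fun s => B.privileged s ω = false ∧ arm s ω = a
    rw [armGroupMean, armGroupMean, abs_le]
    constructor <;> linarith [h1.1, h1.2, h2.1, h2.2]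
  have hs : ∀ x : ℝ, |Real.sign x| ≤ 1 := fun x => by
    rcases Real.sign_apply_eq x with h | h | h <;> simp [h]
  rw [penalty, abs_mul, abs_neg]
  exact mul_le_one₀ (hs _) (abs_nonneg _) hd

/-- Where the estimator is within the confidence radius, the regret of a round is at most
`(2 + γ) α_t` times the width of the pulled arm. -/
lemma IsFairLinUCB.mean_sub_mean_le (hlin : B.IsFairLinUCB lam γ α arm) (hbest : B.IsBestArm best)
    (hγ : 0 ≤ γ) {ω : Ω} (hpay : ∀ s, B.payoff arm ω s ∈ Set.Icc (0 : ℝ) 1) {t : ℕ}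
    (hα : 0 ≤ α t ω)
    (hconf : ∀ a, |inner ℝ (ridge lam (B.pulledX arm ω) (B.payoff arm ω) t) (B.x t a ω)
      - B.mean t a ω| ≤ α t ω * B.width lam arm t a ω) :
    B.mean t (best t ω) ω - B.mean t (arm t ω) ω
      ≤ (2 + γ) * α t ω * B.width lam arm t (arm t ω) ω := by
  have hidx := hlin.index_le t ω (best t ω) (hbest.mem t ω)
  have hb := (abs_le.1 (hconf (best t ω))).1
  have ha := (abs_le.1 (hconf (arm t ω))).2
  have hpb := (abs_le.1 (abs_penalty_le_one hpay t (best t ω))).1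
  have hpa := (abs_le.1 (abs_penalty_le_one hpay t (arm t ω))).2
  have hw : B.minWidth lam arm t ω ≤ B.width lam arm t (arm t ω) ω :=
    Finset.inf'_le _ (hlin.mem t ω)
  have hw0 : 0 ≤ B.minWidth lam arm t ω :=
    (Finset.le_inf'_iff _ _).2 fun a _ => wnorm_nonneg _ _
  -- Two penalties differ by at most 2, which the factor 1/2 cancels. The smallest width is at most
  -- that of the pulled arm.
  have h1 : α t ω * B.minWidth lam arm t ω / 2 * (B.penalty arm t (arm t ω) ω + 1) * γ
      - α t ω * B.minWidth lam arm t ω / 2 * (B.penalty arm t (best t ω) ω + 1) * γ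
      ≤ γ * α t ω * B.width lam arm t (arm t ω) ω := by
    calc _ = γ * α t ω * B.minWidth lam arm t ω
            * ((B.penalty arm t (arm t ω) ω - B.penalty arm t (best t ω) ω) / 2) := by ring
      _ ≤ γ * α t ω * B.minWidth lam arm t ω * 1 := by
          gcongr
          linarith
      _ ≤ _ := by rw [mul_one]; gcongr
  simp only [index] at hidx
  linarith

/-- The determinant ratio is at least 1, so the radius is at least √(2 log T), and 2 log 2 > 1. This
lets the radius absorb the trivial bound 1 on the loss of a round. -/
lemma one_le_confRadius (hlam : 0 < lam) (X : ℕ → Feature d) (θ : Feature d) (t : ℕ) {T : ℕ}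
    (hT : 2 ≤ T) : 1 ≤ confRadius lam (1 / (T : ℝ)) θ X t := by
  have hpos := (gram_posDef hlam X t).det_pos
  have hT' : (2 : ℝ) ≤ T := by exact_mod_cast hT
  have h0 : 0 ≤ Real.log ((gram lam X t).det / lam ^ d) := by
    have h := sum_min_one_le_log_det hlam X t
    have h' : 0 ≤ ∑ s ∈ Finset.range t,
        min 1 ((X s).ofLp ⬝ᵥ (gram lam X s)⁻¹.mulVec (X s).ofLp) :=
      Finset.sum_nonneg fun s _ =>
        le_min zero_le_one (dotProduct_inv_mulVec_nonneg (gram_posDef hlam X s) _)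
    linarith
  have hdet : (lam • (1 : Matrix (Fin d) (Fin d) ℝ)).det = lam ^ d := by simp
  have h1 : 1 / 2 ≤ Real.log (√(gram lam X t).det * (√(lam ^ d))⁻¹ * (1 / (T : ℝ))⁻¹) := by
    rw [← div_eq_mul_inv (√_), ← Real.sqrt_div hpos.le, Real.log_mul (by positivity) (by positivity),
      Real.log_sqrt (by positivity), inv_div, div_one]
    have h2 := Real.log_le_log two_pos hT'
    have h3 := Real.log_two_gt_d9
    linarith
  rw [confRadius, hdet]
  have h2 : 1 ≤ √(2 * Real.log (√(gram lam X t).det * (√(lam ^ d))⁻¹ * (1 / (T : ℝ))⁻¹)) :=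
    Real.one_le_sqrt.2 (by linarith)
  have h3 : 0 ≤ √lam * ‖θ‖ := by positivity
  linarith

/-- The sum of the truncated widths. -/
lemma sum_min_one_width_le (hd : 1 ≤ d) (hlam : 0 < lam) (h : B.Assumptions μ L M)
    (arm : ℕ → Ω → Arm) (T : ℕ) (ω : Ω) :
    ∑ t ∈ Finset.range T, min 1 (B.width lam arm t (arm t ω) ω)
      ≤ √T * √(2 * (d * Real.log (1 + T * L ^ 2 / (d * lam)))) := by
  have hcs := sq_sum_le_card_mul_sum_sq (s := Finset.range T)
    (f := fun t => min 1 (B.width lam arm t (arm t ω) ω))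
  have hsq : ∑ t ∈ Finset.range T, min 1 (B.width lam arm t (arm t ω) ω) ^ 2
      ≤ 2 * (d * Real.log (1 + T * L ^ 2 / (d * lam))) := by
    calc _ ≤ ∑ t ∈ Finset.range T, min 1 ((B.pulledX arm ω t).ofLp
            ⬝ᵥ (gram lam (B.pulledX arm ω) t)⁻¹.mulVec (B.pulledX arm ω t).ofLp) := by
          refine Finset.sum_le_sum fun t _ => ?_
          have hq := dotProduct_inv_mulVec_nonneg (gram_posDef hlam (B.pulledX arm ω) t)
            (B.pulledX arm ω t).ofLp
          have hw : 0 ≤ B.width lam arm t (arm t ω) ω := wnorm_nonneg _ _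
          have hm : 0 ≤ min 1 (B.width lam arm t (arm t ω) ω) := le_min zero_le_one hw
          refine le_min (pow_le_one₀ hm (min_le_left _ _)) ?_
          calc _ ≤ B.width lam arm t (arm t ω) ω ^ 2 := pow_le_pow_left₀ hm (min_le_right _ _) 2
            _ = _ := Real.sq_sqrt hq
      _ ≤ 2 * Real.log ((gram lam (B.pulledX arm ω) T).det / lam ^ d) :=
          sum_min_one_le_log_det hlam _ T
      _ ≤ _ := by
          gcongr
          exact log_det_gram_le hd hlam (fun s => (h.norm_x_lt s _ ω).le) T
  rw [← Real.sqrt_mul (Nat.cast_nonneg T)]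
  refine Real.le_sqrt_of_sq_le (hcs.trans ?_)
  rw [Finset.card_range]
  gcongr

/-- The regret bound on a sample path where the mixture process stays below `T`. -/
lemma regret_le (hd : 1 ≤ d) (hlam : 0 < lam) {T : ℕ} (hT : 2 ≤ T) (hγ : 0 ≤ γ)
    (h : B.Assumptions μ L M) (hexp : B.IsExploration T lam (1 / (T : ℝ)) L M arm α)
    (hlin : B.IsFairLinUCB lam γ α arm) (hbest : B.IsBestArm best) {ω : Ω}
    (hrew : ∀ s a, B.reward s a ω ∈ Set.Icc (0 : ℝ) 1)
    (hmean : ∀ s a, B.mean s a ω ∈ Set.Icc (0 : ℝ) 1)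
    (hmix : ∀ s < T, mixture lam (B.pulledX arm ω) (B.pulledNoise arm ω) s < T) :
    B.regret best arm T ω ≤ (2 + γ) * horizonRadius d T lam (1 / (T : ℝ)) L M
      * (√T * √(2 * (d * Real.log (1 + T * L ^ 2 / (d * lam))))) := by
  have hround : ∀ t ∈ Finset.range T, B.mean t (best t ω) ω - B.mean t (arm t ω) ω
      ≤ (2 + γ) * horizonRadius d T lam (1 / (T : ℝ)) L M
        * min 1 (B.width lam arm t (arm t ω) ω) := by
    intro t ht
    have ht := Finset.mem_range.1 ht
    have hα1 : 1 ≤ α t ω := (one_le_confRadius hlam _ _ t hT).trans (hexp.ge t ht ω)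
    have hw : 0 ≤ B.width lam arm t (arm t ω) ω := wnorm_nonneg _ _
    have hm : 0 ≤ min 1 (B.width lam arm t (arm t ω) ω) := le_min zero_le_one hw
    have hle : B.mean t (best t ω) ω - B.mean t (arm t ω) ω
        ≤ (2 + γ) * α t ω * B.width lam arm t (arm t ω) ω := by
      refine hlin.mean_sub_mean_le hbest hγ (fun s => hrew s _) (by linarith) fun a => ?_
      refine (abs_inner_ridge_sub_le hlam (δ := 1 / (T : ℝ)) _ _ _ B.θ (B.payoff_eq arm ω)
        (by simpa using hmix t ht) (B.x t a ω)).trans ?_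
      exact mul_le_mul_of_nonneg_right (hexp.ge t ht ω) (wnorm_nonneg _ _)
    have hle' : B.mean t (best t ω) ω - B.mean t (arm t ω) ω
        ≤ (2 + γ) * α t ω * min 1 (B.width lam arm t (arm t ω) ω) := by
      -- For a width of at least 1 the loss is at most 1 ≤ (2 + γ) α_t.
      rcases le_total 1 (B.width lam arm t (arm t ω) ω) with h1 | h1
      · rw [min_eq_left h1]
        have := (hmean t (best t ω)).2
        have := (hmean t (arm t ω)).1
        nlinarith
      · rwa [min_eq_right h1]
    refine hle'.trans ?_
    gcongr
    exact hexp.le t ht ω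
  have hH : 0 ≤ horizonRadius d T lam (1 / (T : ℝ)) L M :=
    zero_le_one.trans ((one_le_confRadius hlam (B.pulledX arm ω) B.θ 0 hT).trans
      ((hexp.ge 0 (by omega) ω).trans (hexp.le 0 (by omega) ω)))
  refine (Finset.sum_le_sum hround).trans ?_
  rw [← Finset.mul_sum]
  gcongr
  exact sum_min_one_width_le hd hlam h arm T ω

end Bandit

/-! ### Absorbing the logarithms -/

/-- `log(1 + T L² / λ)` is dominated by `log(T L)`, also after multiplication by `log T`. -/
lemma log_one_add_le {lam c : ℝ} (hlam : 0 < lam) (hc : 1 < c) {T : ℕ} {L : ℝ} (hT : 2 ≤ T)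
    (hTL : c ≤ T * L) :
    Real.log (1 + T * L ^ 2 / lam)
        ≤ (2 + Real.log (1 + 1 / lam) / Real.log c) * Real.log (T * L) ∧
      Real.log (1 + T * L ^ 2 / lam) * Real.log T
        ≤ (4 * (2 + Real.log (1 + 1 / lam) / Real.log c) + 2 / (lam * Real.log c ^ 2))
          * Real.log (T * L) ^ 2 := by
  have hT' : (2 : ℝ) ≤ T := by exact_mod_cast hT
  have hκ : 0 < Real.log c := Real.log_pos hc
  have hD : Real.log c ≤ Real.log (T * L) := Real.log_le_log (by linarith) hTL
  have hlT : 0 ≤ Real.log T := Real.log_nonneg (by linarith)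
  have hl1 : 0 ≤ Real.log (1 + 1 / lam) := Real.log_nonneg (by
    have : 0 < 1 / lam := by positivity
    linarith)
  have hy : 1 ≤ T * L := by linarith
  have hTL2 : T * L ^ 2 = (T * L) ^ 2 / T := by field_simp
  have hl0 : 0 ≤ Real.log (1 + T * L ^ 2 / lam) := Real.log_nonneg (by
    have : 0 ≤ T * L ^ 2 / lam := by positivity
    linarith)
  set D := Real.log (T * L) with hDdef
  have hfirst : Real.log (1 + T * L ^ 2 / lam)
      ≤ (2 + Real.log (1 + 1 / lam) / Real.log c) * D := by
    have h1 : 1 + T * L ^ 2 / lam ≤ (T * L) ^ 2 * (1 + 1 / lam) := by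
      have h2 : T * L ^ 2 ≤ (T * L) ^ 2 := by
        rw [hTL2]; exact div_le_self (by positivity) (by linarith)
      have h3 : 1 ≤ (T * L) ^ 2 := one_le_pow₀ hy
      have h4 : T * L ^ 2 / lam ≤ (T * L) ^ 2 / lam := by gcongr
      calc _ ≤ (T * L) ^ 2 + (T * L) ^ 2 / lam := add_le_add h3 h4
        _ = _ := by ring
    have h5 := Real.log_le_log (by positivity) h1
    rw [Real.log_mul (by positivity) (by positivity), Real.log_pow, ← hDdef] at h5
    have h6 : Real.log (1 + 1 / lam) ≤ Real.log (1 + 1 / lam) / Real.log c * D := by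
      rw [div_mul_eq_mul_div, le_div_iff₀ hκ]
      gcongr
    push_cast at h5
    linarith
  refine ⟨hfirst, ?_⟩
  set a := 2 + Real.log (1 + 1 / lam) / Real.log c with ha
  have ha0 : 0 ≤ a := by positivity
  have hD0 : 0 < D := by linarith
  have hb0 : 0 ≤ 2 / (lam * Real.log c ^ 2) := by positivity
  -- Either log T is comparable to log(T L), or L is so small that T L² = (T L)² / T ≤ 1/√T. In the
  -- latter case the first logarithm is at most 1/(λ√T), which beats log T ≤ 2√T.
  rcases le_total (T : ℝ) ((T * L) ^ 4) with h | h
  · have h1 : Real.log T ≤ 4 * D := by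
      have := Real.log_le_log (by linarith) h
      rwa [Real.log_pow] at this
    calc _ ≤ (a * D) * (4 * D) := by gcongr
      _ ≤ (a * D) * (4 * D) + 2 / (lam * Real.log c ^ 2) * D ^ 2 := by
          linarith [mul_nonneg hb0 (sq_nonneg D)]
      _ = _ := by ring
  · have hs : 0 < √(T : ℝ) := Real.sqrt_pos.2 (by linarith)
    have h1 : Real.log (1 + T * L ^ 2 / lam) ≤ 1 / (√T * lam) := by
      have h2 : (T * L) ^ 2 ≤ √(T : ℝ) := Real.le_sqrt_of_sq_le (by rw [← pow_mul]; exact h)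
      have h3 := Real.log_le_sub_one_of_pos (x := 1 + T * L ^ 2 / lam) (by positivity)
      have h4 : T * L ^ 2 / lam ≤ √(T : ℝ) / T / lam := by
        rw [hTL2]
        gcongr
      have h5 : √(T : ℝ) / T / lam = 1 / (√T * lam) := by
        rw [Real.sqrt_div_self', div_div]
      linarith
    have h2 : Real.log T ≤ 2 * √T := by
      have h3 := Real.log_le_sub_one_of_pos hs
      rw [Real.log_sqrt (by linarith)] at h3
      linarith
    calc _ ≤ 1 / (√T * lam) * (2 * √T) := by gcongr
      _ = 2 / (lam * Real.log c ^ 2) * Real.log c ^ 2 := by field_simp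
      _ ≤ 2 / (lam * Real.log c ^ 2) * D ^ 2 := by gcongr
      _ ≤ 2 / (lam * Real.log c ^ 2) * D ^ 2 + 4 * a * D ^ 2 := by
          linarith [mul_nonneg (mul_nonneg zero_le_four ha0) (sq_nonneg D)]
      _ = _ := by ring

/-- The additional 1 is reserved for the bad event in the expected regret. -/
lemma exists_const_regret_le (lam M Γ c : ℝ) (hlam : 0 < lam) (hΓ : 0 ≤ Γ) (hc : 1 < c) :
    ∃ C : ℝ, 0 < C ∧ ∀ (d T : ℕ) (L γ : ℝ), 1 ≤ d → 2 ≤ T → c ≤ T * L → 0 ≤ γ → γ ≤ Γ →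
      (2 + γ) * horizonRadius d T lam (1 / (T : ℝ)) L M
        * (√T * √(2 * (d * Real.log (1 + T * L ^ 2 / (d * lam))))) + 1
        ≤ C * d * √(T : ℝ) * Real.log (T * L) := by
  have hκ : 0 < Real.log c := Real.log_pos hc
  have hl1 : 0 ≤ Real.log (1 + 1 / lam) := Real.log_nonneg (by
    have : 0 < 1 / lam := by positivity
    linarith)
  set a := 2 + Real.log (1 + 1 / lam) / Real.log c with ha
  set b := 4 * a + 2 / (lam * Real.log c ^ 2) with hb
  have ha0 : 0 ≤ a := by positivity
  have hb0 : 0 ≤ b := by positivity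
  -- The summands come from `e1`, `e2` and `e4`. Divisions by log c trade a missing factor log(T L)
  -- for a constant, and `|M|` ensures positivity without a sign condition on `M`.
  refine ⟨(2 + Γ) * (√lam * |M| * √(2 * a / Real.log c) + √(4 * b + 2 * a ^ 2)) + 1 / Real.log c,
    by positivity, ?_⟩
  intro d T L γ hd hT hTL hγ hγΓ
  have hd' : (1 : ℝ) ≤ d := by exact_mod_cast hd
  have hT' : (2 : ℝ) ≤ T := by exact_mod_cast hT
  obtain ⟨h1, h2⟩ := log_one_add_le hlam hc hT hTL
  rw [← ha] at h1 h2
  rw [← hb] at h2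
  have hD : Real.log c ≤ Real.log (T * L) := Real.log_le_log (by linarith) hTL
  have hlT : 0 ≤ Real.log T := Real.log_nonneg (by linarith)
  set D := Real.log (T * L)
  have hD0 : 0 < D := by linarith
  set l := Real.log (1 + T * L ^ 2 / (d * lam)) with hl
  have hl0 : 0 ≤ l := Real.log_nonneg (by
    have : 0 ≤ T * L ^ 2 / (d * lam) := by positivity
    linarith)
  have hll : l ≤ Real.log (1 + T * L ^ 2 / lam) := by
    refine Real.log_le_log (by positivity) ?_
    gcongr
    exact le_mul_of_one_le_left hlam.le hd'
  have hla : l ≤ a * D := hll.trans h1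
  have hlb : l * Real.log T ≤ b * D ^ 2 := (mul_le_mul_of_nonneg_right hll hlT).trans h2
  have hdd : (d : ℝ) ≤ d ^ 2 := by nlinarith
  have e1 : √(2 * (d * l)) ≤ d * D * √(2 * a / Real.log c) := by
    rw [← Real.sqrt_sq (by positivity : 0 ≤ d * D), ← Real.sqrt_mul (by positivity)]
    refine Real.sqrt_le_sqrt ?_
    calc 2 * (d * l) ≤ 2 * (d ^ 2 * (a * D)) := by gcongr
      _ = 2 * a / Real.log c * d ^ 2 * D * Real.log c := by field_simp
      _ ≤ 2 * a / Real.log c * d ^ 2 * D * D := by gcongr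
      _ = _ := by ring
  -- The roots must be multiplied before estimating: log T alone need not be bounded by a multiple
  -- of log(T L), only its product with `l` is bounded by one of log(T L)².
  have e2 : √(2 * Real.log (1 / (1 / (T : ℝ))) + d * l) * √(2 * (d * l))
      ≤ d * D * √(4 * b + 2 * a ^ 2) := by
    rw [one_div_one_div, ← Real.sqrt_mul (by positivity),
      ← Real.sqrt_sq (by positivity : 0 ≤ d * D), ← Real.sqrt_mul (by positivity)]
    refine Real.sqrt_le_sqrt ?_
    calc _ = 4 * (d * (l * Real.log T)) + 2 * d ^ 2 * l ^ 2 := by ring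
      _ ≤ 4 * (d ^ 2 * (b * D ^ 2)) + 2 * d ^ 2 * (a * D) ^ 2 := by gcongr
      _ = _ := by ring
  have e3 : horizonRadius d T lam (1 / (T : ℝ)) L M * √(2 * (d * l))
      ≤ d * D * (√lam * |M| * √(2 * a / Real.log c) + √(4 * b + 2 * a ^ 2)) := by
    rw [horizonRadius, ← hl, add_mul]
    have : √lam * M * √(2 * (d * l)) ≤ √lam * |M| * (d * D * √(2 * a / Real.log c)) := by
      gcongr
      exact le_abs_self M
    linarith
  have hs : 1 ≤ √(T : ℝ) := Real.one_le_sqrt.2 (by linarith)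
  have e4 : 1 ≤ 1 / Real.log c * (d * √T * D) := by
    rw [div_mul_eq_mul_div, one_mul, le_div_iff₀ hκ, one_mul]
    calc Real.log c ≤ D := hD
      _ = 1 * 1 * D := by ring
      _ ≤ _ := by gcongr
  calc _ = (2 + γ) * √T * (horizonRadius d T lam (1 / (T : ℝ)) L M * √(2 * (d * l))) + 1 := by ring
    _ ≤ (2 + Γ) * √T * (d * D * (√lam * |M| * √(2 * a / Real.log c) + √(4 * b + 2 * a ^ 2)))
        + 1 / Real.log c * (d * √T * D) := by
        refine add_le_add ?_ e4
        refine (mul_le_mul_of_nonneg_left e3 (by positivity)).trans ?_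
        gcongr
    _ = _ := by ring

end FairLinUCB

/-! ### The high-probability and the expected regret bound -/

theorem mainTheorem2 (lam M Γ c : ℝ) (hlam : 0 < lam) (hΓ : 0 ≤ Γ) (hc : 1 < c) :
    ∃ C : ℝ, 0 < C ∧
      ∀ (d T : ℕ) (L : ℝ), 1 ≤ d → 2 ≤ T → c ≤ T * L →
      ∀ (Ω Arm : Type*) [MeasurableSpace Ω] [Finite Arm]
        (μ : MeasureTheory.Measure Ω) [MeasureTheory.IsProbabilityMeasure μ]
        (B : FairLinUCB.Bandit d Arm Ω) (γ : ℝ) (α : ℕ → Ω → ℝ) (arm best : ℕ → Ω → Arm),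
        B.Assumptions μ L M →
        0 ≤ γ → γ ≤ Γ →
        B.IsExploration T lam (1 / (T : ℝ)) L M arm α →
        B.IsFairLinUCB lam γ α arm →
        B.IsBestArm best →
        1 - 1 / (T : ℝ) ≤
            μ.real {ω | B.regret best arm T ω ≤ C * d * √(T : ℝ) * Real.log (T * L)} ∧
          B.expectedRegret μ best arm T ≤ C * d * √(T : ℝ) * Real.log (T * L) := by
  obtain ⟨C, hC, hbound⟩ := FairLinUCB.exists_const_regret_le lam M Γ c hlam hΓ hc
  refine ⟨C, hC, ?_⟩
  intro d T L hd hT hTL Ω Arm _ _ μ _ B γ α arm best h hγ hγΓ hexp hlin hbest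
  have hT' : (0 : ℝ) < T := by
    have : 0 < T := by omega
    exact_mod_cast this
  have hC1 := hbound d T L γ hd hT hTL hγ hγΓ
  set U := C * d * √(T : ℝ) * Real.log (T * L)
  have hmeas : ∀ s, Measurable fun ω => FairLinUCB.mixture lam (B.pulledX arm ω)
      (B.pulledNoise arm ω) s := fun s =>
    (h.measurable_mixture hlin.predictable hlin.payoff_observed s).mono (B.F.le s) le_rfl
  set bad : Set Ω := {ω | ∃ s < T, (T : ℝ) ≤ FairLinUCB.mixture lam (B.pulledX arm ω)
    (B.pulledNoise arm ω) s} with hbad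
  have hbadm : MeasurableSet bad := by
    have : bad = ⋃ s, ⋃ _ : s < T, {ω | (T : ℝ) ≤ FairLinUCB.mixture lam (B.pulledX arm ω)
        (B.pulledNoise arm ω) s} := by
      ext ω
      simp [hbad]
    rw [this]
    exact MeasurableSet.iUnion fun s => MeasurableSet.iUnion fun _ =>
      measurableSet_le measurable_const (hmeas s)
  have hbadμ : μ.real bad ≤ 1 / T :=
    h.measureReal_mixture_ge_le hlam hlin.predictable hlin.payoff_observed hT' T
  have hrew : ∀ᵐ ω ∂μ, ∀ s a, B.reward s a ω ∈ Set.Icc (0 : ℝ) 1 :=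
    MeasureTheory.ae_all_iff.2 fun s => MeasureTheory.ae_all_iff.2 fun a => h.reward_mem s a
  have hmean : ∀ᵐ ω ∂μ, ∀ s a, B.mean s a ω ∈ Set.Icc (0 : ℝ) 1 :=
    MeasureTheory.ae_all_iff.2 fun s => MeasureTheory.ae_all_iff.2 fun a => h.mean_mem_Icc s a
  have hgood : ∀ᵐ ω ∂μ, ω ∉ bad → B.regret best arm T ω + 1 ≤ U := by
    filter_upwards [hrew, hmean] with ω h1 h2 hω
    have := FairLinUCB.Bandit.regret_le hd hlam hT hγ h hexp hlin hbest h1 h2 fun s hs =>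
      not_le.1 fun hle => hω ⟨s, hs, hle⟩
    linarith
  constructor
  · have h1 : μ.real badᶜ ≤ μ.real {ω | B.regret best arm T ω ≤ U} := by
      refine ENNReal.toReal_mono (MeasureTheory.measure_ne_top _ _) (MeasureTheory.measure_mono_ae ?_)
      filter_upwards [hgood] with ω hω hb
      have := hω hb
      show B.regret best arm T ω ≤ U
      linarith
    rw [MeasureTheory.probReal_compl_eq_one_sub hbadm] at h1
    linarith
  · rw [h.expectedRegret_eq hbest.predictable hlin.predictable]
    have hind : MeasureTheory.Integrable (bad.indicator fun _ => (T : ℝ)) μ :=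
      (MeasureTheory.integrable_const _).indicator hbadm
    -- Needed on the bad event, where the regret is only known to be at most T, for the common bound
    -- (U - 1) + T · 1_bad.
    have hU : 0 ≤ U - 1 := by
      have hM : 0 ≤ M := (norm_nonneg _).trans h.norm_θ_lt.le
      have hH : 0 ≤ FairLinUCB.horizonRadius d T lam (1 / (T : ℝ)) L M := by
        rw [FairLinUCB.horizonRadius]; positivity
      have : 0 ≤ (2 + γ) * FairLinUCB.horizonRadius d T lam (1 / (T : ℝ)) L M
          * (√T * √(2 * (d * Real.log (1 + T * L ^ 2 / (d * lam))))) := by positivity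
      linarith
    calc ∫ ω, B.regret best arm T ω ∂μ
        ≤ ∫ ω, ((U - 1) + bad.indicator (fun _ => (T : ℝ)) ω) ∂μ := by
          refine MeasureTheory.integral_mono_ae
            (h.integrable_regret hbest.predictable hlin.predictable T)
            ((MeasureTheory.integrable_const _).add hind) ?_
          filter_upwards [hgood, hmean] with ω h1 h2
          by_cases hω : ω ∈ bad
          · have : B.regret best arm T ω ≤ T := by
              refine (Finset.sum_le_card_nsmul (Finset.range T) _ (1 : ℝ) fun t _ => ?_).trans_eq
                (by simp)
              linarith [(h2 t (best t ω)).2, (h2 t (arm t ω)).1]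
            simp only [Set.indicator_of_mem hω]
            linarith
          · simp only [Set.indicator_of_notMem hω]
            linarith [h1 hω]
      _ = (U - 1) + T * μ.real bad := by
          rw [MeasureTheory.integral_add (MeasureTheory.integrable_const _) hind,
            MeasureTheory.integral_indicator hbadm]
          simp [mul_comm]
      _ ≤ (U - 1) + T * (1 / T) := by gcongr
      _ = U := by field_simp; ring
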